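/- All graphs are finite and loopless; parallel edges are allowed. A graph is cubic if every vertex is incident with exactly three edges, and $3$-connected if it has more than three vertices and remains connected after the deletion of any set of fewer than three vertices. An edge is called lonely if it belongs to exactly one perfect matching of the graph, and $l(G)$ denotes the number of lonely edges of $G$. Let $\mathcal{U}$ be the class of $3$-connected cubic graphs having at least one lonely edge, and for $k\ge 1$ let $\mathcal{U}_k$ be the class of all $G\in\mathcal{U}$ with $l(G)=k$. Let the prism be the graph consisting of two disjoint triangles joined by a perfect matching (three edges), and let the bicorn be the graph obtained from the prism by replacing a vertex $v$ with a triangle, i.e. by deleting $v$, adding three new pairwise adjacent vertices, and joining these by a perfect matching to the three neighbours of $v$. Then: 1. $l(G)\le 6$ for every $G\in\mathcal{U}$; 2. up to isomorphism, $K_4$ and the prism are the only elements of $\mathcal{U}_6$ (and both belong to $\mathcal{U}_6$); 3. up to isomorphism, the bicorn is the only element of $\mathcal{U}_5$ (and it belongs to $\mathcal{U}_5$). -/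

import Mathlib

namespace Graph

universe u v u' v'

variable {α : Type u} {β : Type v} {α' : Type u'} {β' : Type v'}

/-- A (multi)graph is cubic if it has no loops and every vertex is incident with exactly three
edges. Parallel edges are allowed. -/
def IsCubic (G : Graph α β) : Prop :=
  G.Loopless ∧ ∀ x ∈ V(G), (G.incidenceSet x).encard = 3

/-- A graph is connected if it has a vertex and any two vertices are joined by a walk. -/
def IsConnected (G : Graph α β) : Prop :=
  V(G).Nonempty ∧ ∀ x ∈ V(G), ∀ y ∈ V(G), Relation.ReflTransGen G.Adj x y

/-- A graph is (vertex-)`k`-connected if it has more than `k` vertices and it stays connected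
whenever fewer than `k` vertices are deleted. -/
def IsVertexConnected (k : ℕ) (G : Graph α β) : Prop :=
  (k : ℕ∞) < V(G).encard ∧
    ∀ X ⊆ V(G), X.encard < (k : ℕ∞) → (G.deleteVerts X).IsConnected

/-- A perfect matching, as a set of edges: every vertex is incident with exactly one of them. -/
def IsPerfectMatching (G : Graph α β) (M : Set β) : Prop :=
  M ⊆ E(G) ∧ ∀ x ∈ V(G), ∃! e, e ∈ M ∧ G.Inc e x

/-- An edge is lonely if it belongs to exactly one perfect matching. -/
def IsLonely (G : Graph α β) (e : β) : Prop :=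
  e ∈ E(G) ∧ ∃! M : Set β, G.IsPerfectMatching M ∧ e ∈ M

/-- The number `l(G)` of lonely edges of `G`. -/
noncomputable def lonelyCount (G : Graph α β) : ℕ∞ :=
  {e | G.IsLonely e}.encard

/-- The class `𝒰` of finite 3-connected cubic graphs with at least one lonely edge. -/
def MemU (G : Graph α β) : Prop :=
  V(G).Finite ∧ G.IsCubic ∧ G.IsVertexConnected 3 ∧ ∃ e, G.IsLonely e

/-- The class `𝒰ₖ` of the graphs in `𝒰` with exactly `k` lonely edges. -/
def MemUExactly (k : ℕ) (G : Graph α β) : Prop :=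
  G.MemU ∧ G.lonelyCount = (k : ℕ∞)

/-- Isomorphism of (multi)graphs: bijections between the vertex sets and between the edge sets
that preserve and reflect which edge joins which vertices. -/
def IsIsomorphic (G : Graph α β) (H : Graph α' β') : Prop :=
  ∃ (φ : V(G) ≃ V(H)) (ψ : E(G) ≃ E(H)), ∀ (e : E(G)) (x y : V(G)),
    G.IsLink (e : β) (x : α) (y : α) ↔ H.IsLink (ψ e : β') (φ x : α') (φ y : α')

/-- The complete graph on four vertices. -/
def completeFour : Graph (Fin 4) (Sym2 (Fin 4)) :=
  ofSimpleGraph (⊤ : SimpleGraph (Fin 4))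

/-- The prism: two disjoint triangles `012` and `345`, joined by the perfect matching
`03`, `14`, `25`. -/
def prism : Graph (Fin 6) (Sym2 (Fin 6)) :=
  ofSimpleGraph (SimpleGraph.fromEdgeSet
    {s(0, 1), s(1, 2), s(0, 2),
     s(3, 4), s(4, 5), s(3, 5),
     s(0, 3), s(1, 4), s(2, 5)})

/-- The bicorn: the prism with triangles `567` and `a34`, matching edges `45`, `37`, `a6`,
in which the triangle-vertex `a` has been replaced by the triangle `012`
(so `a4`, `a6`, `a3` become `04`, `16`, `23`). -/
def bicorn : Graph (Fin 8) (Sym2 (Fin 8)) :=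
  ofSimpleGraph (SimpleGraph.fromEdgeSet
    {s(0, 1), s(1, 2), s(0, 2),
     s(0, 4), s(1, 6), s(2, 3),
     s(3, 4), s(4, 5), s(3, 7),
     s(5, 6), s(5, 7), s(6, 7)})

end Graph

/-!
Let `uv` be a lonely edge of a 3-connected cubic graph `G`. Deleting `u` and `v` leaves a vertex set
with four leaving edges and a unique perfect matching. By Kotzig's argument such a set has a
matching edge that is a bridge: otherwise deleting a matching edge leaves a Tutte barrier, all of
whose inequalities are tight because every odd component sends at least three edges out, and
following the edges that leave these components around a cycle rotates the matching into a second
one. Three edges leave each side of the bridge, so removing the end of the bridge from a side with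
more than one vertex yields a smaller set of the same kind, and the descent ends in a triangle.
Hence `G` is `K₄`, or it arises from a smaller 3-edge-connected cubic graph by replacing a vertex
with a triangle.

Perfect matchings of the smaller graph lift to `G`, and the edges leaving the triangle are never
lonely, so the lonely edges of `G` inject into those of the smaller graph. As `K₄` and the prism are
vertex-transitive, the first two replacements give the prism and the bicorn. Replacing a vertex of
the bicorn destroys a lonely edge, so only four can remain from there on.
-/

namespace LonelyEdge

open Finset

section EdgeCount

variable {V : Type*} {G : SimpleGraph V} {A B X Y Z : Finset V} {x y z : V}

open Classical in
/-- The number of edges between `X` and `Y`, counted as ordered pairs: an edge with both ends in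
`X ∩ Y` counts twice. -/
noncomputable def edgeCount (G : SimpleGraph V) (X Y : Finset V) : ℕ :=
  #(G.interedges X Y)

theorem edgeCount_comm (X Y : Finset V) : edgeCount G X Y = edgeCount G Y X := by
  classical
  have := G.symm
  exact Rel.card_interedges_comm X Y

theorem edgeCount_mono {X' Y' : Finset V} (hX : X ⊆ X') (hY : Y ⊆ Y') :
    edgeCount G X Y ≤ edgeCount G X' Y' := by
  classical exact card_le_card (G.interedges_mono hX hY)

theorem edgeCount_empty_left (Y : Finset V) : edgeCount G ∅ Y = 0 := by
  simp [edgeCount]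

theorem edgeCount_empty_right (X : Finset V) : edgeCount G X ∅ = 0 := by
  rw [edgeCount_comm, edgeCount_empty_left]

theorem edgeCount_eq_zero_iff : edgeCount G X Y = 0 ↔ ∀ x ∈ X, ∀ y ∈ Y, ¬ G.Adj x y := by
  simp only [edgeCount, card_eq_zero, eq_empty_iff_forall_notMem, SimpleGraph.mem_interedges_iff,
    Prod.forall, not_and]
  exact ⟨fun h x hx y => h x y hx, fun h x y hx => h x hx y⟩

theorem edgeCount_pos (hx : x ∈ X) (hy : y ∈ Y) (h : G.Adj x y) : 0 < edgeCount G X Y := by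
  classical exact card_pos.2 ⟨(x, y), G.mk_mem_interedges_iff.2 ⟨hx, hy, h⟩⟩

theorem edgeCount_singleton [DecidableRel G.Adj] (x : V) (Y : Finset V) :
    edgeCount G {x} Y = #{y ∈ Y | G.Adj x y} := by
  have hinst : edgeCount G {x} Y = #(G.interedges {x} Y) := by unfold edgeCount; congr!
  rw [hinst, SimpleGraph.interedges_def, singleton_product, filter_map, card_map]
  rfl

theorem edgeCount_singleton_self : edgeCount G {x} {x} = 0 := by
  simp [edgeCount_eq_zero_iff]

theorem edgeCount_pair (h : G.Adj x y) : edgeCount G {x} {y} = 1 := by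
  classical
  simp [edgeCount_singleton, filter_singleton, h]

theorem two_le_edgeCount (hy : y ∈ Y) (hz : z ∈ Y) (hyz : y ≠ z) (hxy : G.Adj x y)
    (hxz : G.Adj x z) : 2 ≤ edgeCount G {x} Y := by
  classical
  rw [edgeCount_singleton, Nat.succ_le_iff, one_lt_card]
  exact ⟨y, by simp [*], z, by simp [*], hyz⟩

theorem edgeCount_union_left [DecidableEq V] (h : Disjoint X Y) (Z : Finset V) :
    edgeCount G (X ∪ Y) Z = edgeCount G X Z + edgeCount G Y Z := by
  classical
  have hunion : G.interedges (X ∪ Y) Z = G.interedges X Z ∪ G.interedges Y Z := by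
    simp only [SimpleGraph.interedges_def, union_product, filter_union]
  simp only [edgeCount, hunion, card_union_of_disjoint (G.interedges_disjoint_left h Z)]

theorem edgeCount_union_right [DecidableEq V] (h : Disjoint X Y) (Z : Finset V) :
    edgeCount G Z (X ∪ Y) = edgeCount G Z X + edgeCount G Z Y := by
  rw [edgeCount_comm, edgeCount_union_left h, edgeCount_comm X, edgeCount_comm Y]

theorem edgeCount_biUnion_left [DecidableEq V] {ι : Type*} {s : Finset ι} {f : ι → Finset V}
    (h : (s : Set ι).PairwiseDisjoint f) (Z : Finset V) :
    edgeCount G (s.biUnion f) Z = ∑ i ∈ s, edgeCount G (f i) Z := by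
  classical
  simp only [edgeCount]
  rw [SimpleGraph.interedges_biUnion_left, card_biUnion]
  exact fun i hi j hj hij => G.interedges_disjoint_left (h hi hj hij) Z

theorem edgeCount_eq_sum (X Y : Finset V) : edgeCount G X Y = ∑ x ∈ X, edgeCount G {x} Y := by
  classical
  rw [← edgeCount_biUnion_left (fun _ _ _ _ h => disjoint_singleton.2 h), biUnion_singleton_eq_self]

theorem even_edgeCount_self (X : Finset V) : Even (edgeCount G X X) := by
  classical
  induction X using Finset.induction_on with
  | empty => simp [edgeCount_empty_left]
  | insert a s ha ih =>
    have hd : Disjoint {a} s := disjoint_singleton_left.2 ha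
    rw [insert_eq, edgeCount_union_left hd, edgeCount_union_right hd, edgeCount_union_right hd,
      edgeCount_singleton_self, edgeCount_comm s {a}]
    obtain ⟨k, hk⟩ := ih
    exact ⟨edgeCount G {a} s + k, by omega⟩

variable [Fintype V] [DecidableEq V]

/-- The number of edges leaving `X`. -/
noncomputable def boundary (G : SimpleGraph V) (X : Finset V) : ℕ :=
  edgeCount G X Xᶜ

theorem edgeCount_add_edgeCount_compl (X Y : Finset V) :
    edgeCount G X Y + edgeCount G X Yᶜ = edgeCount G X univ := by
  rw [← edgeCount_union_right disjoint_compl_right, union_compl]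

theorem boundary_singleton (x : V) : boundary G {x} = edgeCount G {x} univ := by
  rw [← edgeCount_add_edgeCount_compl {x} {x}, edgeCount_singleton_self, zero_add, boundary]

theorem boundary_union (h : Disjoint A B) :
    boundary G (A ∪ B) + 2 * edgeCount G A B = boundary G A + boundary G B := by
  have hA : Aᶜ = B ∪ (A ∪ B)ᶜ := by
    rw [compl_union, union_inter_distrib_left, union_compl, inter_univ,
      union_eq_right.2 (subset_compl_iff_disjoint_left.2 h)]
  have hB : Bᶜ = A ∪ (A ∪ B)ᶜ := by
    rw [compl_union, union_inter_distrib_left, union_compl, univ_inter,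
      union_eq_right.2 (subset_compl_iff_disjoint_right.2 h)]
  have hdA : Disjoint A (A ∪ B)ᶜ := disjoint_compl_right.mono_left subset_union_left
  have hdB : Disjoint B (A ∪ B)ᶜ := disjoint_compl_right.mono_left subset_union_right
  unfold boundary
  rw [edgeCount_union_left h, hA, hB, edgeCount_union_right hdB, edgeCount_union_right hdA,
    edgeCount_comm B A]
  ring

theorem boundary_erase (hx : x ∈ X) :
    boundary G (X.erase x) + 2 * edgeCount G {x} Xᶜ = boundary G X + boundary G {x} := by
  have hd : Disjoint {x} (X.erase x) := by simp
  have hunion := boundary_union (G := G) hd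
  rw [← insert_eq, insert_erase hx] at hunion
  have hsplit : {x}ᶜ = X.erase x ∪ Xᶜ := by
    rw [← compl_inj_iff, compl_union, compl_compl, compl_compl, compl_erase, inter_comm]
    simp [inter_insert_of_mem hx]
  have hcount : boundary G {x} = edgeCount G {x} (X.erase x) + edgeCount G {x} Xᶜ := by
    rw [boundary, hsplit, edgeCount_union_right (disjoint_compl_right.mono_left (erase_subset _ _))]
  omega

end EdgeCount

section Matching

variable {V : Type*} {G : SimpleGraph V} {U W : Finset V} {x y v : V} {m n : V → V}

/-- The map `m` encodes a perfect matching of the subgraph of `G` induced on `W`: it sends every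
vertex of `W` to its partner and fixes every other vertex. -/
structure IsMatchingOn (G : SimpleGraph V) (W : Finset V) (m : V → V) : Prop where
  involutive : Function.Involutive m
  adj : ∀ v ∈ W, G.Adj v (m v)
  apply_of_notMem : ∀ v ∉ W, m v = v

/-- The map `m` encodes the only perfect matching of the subgraph of `G` induced on `W`. -/
structure IsUniqueMatchingOn (G : SimpleGraph V) (W : Finset V) (m : V → V) : Prop where
  isMatchingOn : IsMatchingOn G W m
  eq_of_isMatchingOn : ∀ n, IsMatchingOn G W n → n = m

theorem IsMatchingOn.apply_mem (h : IsMatchingOn G W m) (hv : v ∈ W) : m v ∈ W := by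
  by_contra hmv
  have hfix : v = m v := (h.involutive v).symm.trans (h.apply_of_notMem _ hmv)
  exact (h.adj v hv).ne hfix

theorem IsMatchingOn.even_card (h : IsMatchingOn G W m) : Even #W := by
  have hsum : ∑ _x ∈ W, (1 : ZMod 2) = 0 :=
    sum_involution (fun v _ => m v) (fun _ _ => by decide) (fun v hv _ => (h.adj v hv).ne')
      (fun _ hv => h.apply_mem hv) fun v _ => h.involutive v
  rwa [sum_const, nsmul_one, ZMod.natCast_eq_zero_iff_even] at hsum

theorem IsMatchingOn.mono {H : SimpleGraph V} (hle : G ≤ H) (h : IsMatchingOn G W m) :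
    IsMatchingOn H W m :=
  ⟨h.involutive, fun v hv => hle (h.adj v hv), h.apply_of_notMem⟩

theorem isMatchingOn_empty (G : SimpleGraph V) : IsMatchingOn G ∅ id :=
  ⟨fun _ => rfl, by simp, by simp⟩

theorem isMatchingOn_swap [DecidableEq V] (h : G.Adj x y) :
    IsMatchingOn G {x, y} (Equiv.swap x y) := by
  refine ⟨fun v => by simp, fun v hv => ?_, fun v hv => ?_⟩
  · obtain rfl | rfl : v = x ∨ v = y := by simpa using hv
    · rwa [Equiv.swap_apply_left]
    · rw [Equiv.swap_apply_right]; exact h.symm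
  · simp only [mem_insert, mem_singleton, not_or] at hv
    exact Equiv.swap_apply_of_ne_of_ne hv.1 hv.2

theorem IsMatchingOn.union [DecidableEq V] (hm : IsMatchingOn G U m) (hn : IsMatchingOn G W n)
    (hd : Disjoint U W) : IsMatchingOn G (U ∪ W) (n ∘ m) := by
  have hU : ∀ v ∈ U, n (m v) = m v := fun v hv =>
    hn.apply_of_notMem _ (disjoint_left.1 hd (hm.apply_mem hv))
  have hW : ∀ v ∉ U, n (m v) = n v := fun v hv => by rw [hm.apply_of_notMem v hv]
  have hnU : ∀ v ∉ U, n v ∉ U := fun v hv hnv =>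
    hv (hn.involutive v ▸ (hn.apply_of_notMem _ (disjoint_left.1 hd hnv)).symm ▸ hnv)
  refine ⟨fun v => ?_, fun v hv => ?_, fun v hv => ?_⟩
  · by_cases hv : v ∈ U
    · simp only [Function.comp_apply, hU v hv, hm.involutive v,
        hn.apply_of_notMem v (disjoint_left.1 hd hv)]
    · simp only [Function.comp_apply, hW v hv, hW _ (hnU v hv), hn.involutive v]
  · by_cases hvU : v ∈ U
    · simpa only [Function.comp_apply, hU v hvU] using hm.adj v hvU
    · simpa only [Function.comp_apply, hW v hvU] using
        hn.adj v ((mem_union.1 hv).resolve_left hvU)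
  · rw [mem_union, not_or] at hv
    rw [Function.comp_apply, hW v hv.1, hn.apply_of_notMem v hv.2]

theorem IsMatchingOn.insert_insert [DecidableEq V] (hn : IsMatchingOn G U n) (hx : x ∉ U)
    (hy : y ∉ U) (h : G.Adj x y) :
    IsMatchingOn G (insert x (insert y U)) (n ∘ Equiv.swap x y) := by
  have hd : Disjoint {x, y} U := by simp [hx, hy]
  simpa [insert_union] using (isMatchingOn_swap h).union hn hd

theorem exists_isMatchingOn_biUnion [DecidableEq V] {ι : Type*} {s : Finset ι}
    {f : ι → Finset V} {n : ι → V → V} (hd : (s : Set ι).PairwiseDisjoint f)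
    (hn : ∀ i ∈ s, IsMatchingOn G (f i) (n i)) :
    ∃ m, IsMatchingOn G (s.biUnion f) m ∧ ∀ i ∈ s, ∀ v ∈ f i, m v = n i v := by
  classical
  induction s using Finset.induction_on with
  | empty => exact ⟨id, isMatchingOn_empty G, by simp⟩
  | insert i s hi ih =>
    rw [coe_insert] at hd
    obtain ⟨m, hm, hmn⟩ := ih (hd.subset (Set.subset_insert _ _))
      fun j hj => hn j (mem_insert_of_mem hj)
    have hdi : Disjoint (f i) (s.biUnion f) := (disjoint_biUnion_right _ _ _).2 fun j hj =>
      hd (Set.mem_insert _ _) (Set.mem_insert_of_mem _ hj) (ne_of_mem_of_not_mem hj hi).symm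
    have hni := hn i (mem_insert_self i s)
    refine ⟨m ∘ n i, ?_, fun j hj v hv => ?_⟩
    · rw [biUnion_insert]
      exact hni.union hm hdi
    · obtain rfl | hj := mem_insert.1 hj
      · exact hm.apply_of_notMem _ (disjoint_left.1 hdi (hni.apply_mem hv))
      · rw [Function.comp_apply, hni.apply_of_notMem v fun hvi =>
          disjoint_left.1 hdi hvi (mem_biUnion.2 ⟨j, hj, hv⟩), hmn j hj v hv]

theorem IsMatchingOn.restrict [DecidableEq V] (hm : IsMatchingOn G W m) (hU : U ⊆ W)
    (hinv : ∀ v ∈ U, m v ∈ U) :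
    IsMatchingOn G U fun v => if v ∈ U then m v else v := by
  refine ⟨fun v => ?_, fun v hv => ?_, fun v hv => if_neg hv⟩
  · by_cases hv : v ∈ U
    · simp [hv, hinv v hv, hm.involutive v]
    · simp [hv]
  · simpa [hv] using hm.adj v (hU hv)

theorem IsMatchingOn.apply_mem_sdiff [DecidableEq V] (hm : IsMatchingOn G W m)
    (hinv : ∀ v ∈ U, m v ∈ U) : ∀ v ∈ W \ U, m v ∈ W \ U := by
  intro v hv
  rw [mem_sdiff] at hv ⊢
  exact ⟨hm.apply_mem hv.1, fun h => hv.2 (hm.involutive v ▸ hinv _ h)⟩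

theorem IsUniqueMatchingOn.eqOn (hm : IsUniqueMatchingOn G W m) (hU : U ⊆ W)
    (hinv : ∀ v ∈ U, m v ∈ U) (hn : IsMatchingOn G U n) : Set.EqOn n m U := by
  classical
  have hrest := hm.isMatchingOn.restrict sdiff_subset (hm.isMatchingOn.apply_mem_sdiff hinv)
  have hunion := hn.union hrest disjoint_sdiff
  rw [union_sdiff_of_subset hU] at hunion
  intro v hv
  simpa [hn.apply_mem hv] using congrFun (hm.eq_of_isMatchingOn _ hunion) v

theorem IsUniqueMatchingOn.restrict [DecidableEq V] (hm : IsUniqueMatchingOn G W m) (hU : U ⊆ W)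
    (hinv : ∀ v ∈ U, m v ∈ U) : IsUniqueMatchingOn G U fun v => if v ∈ U then m v else v := by
  refine ⟨hm.isMatchingOn.restrict hU hinv, fun n hn => funext fun v => ?_⟩
  by_cases hv : v ∈ U
  · simpa [hv] using hm.eqOn hU hinv hn hv
  · simpa [hv] using hn.apply_of_notMem v hv

end Matching

section Tutte

variable {V : Type*} {G : SimpleGraph V}

/-- What Tutte's theorem provides when the subgraph of `G` induced on a set `W` of even size has no
perfect matching: a set `S` together with at least `#S + 2` pairwise disjoint odd sets, each of
which is closed under adjacency in `W \ S`. -/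
structure IsTutteFamily (G : SimpleGraph V) (W S : Finset V) (F : Finset (Finset V)) : Prop where
  barrier_subset : S ⊆ W
  subset : ∀ C ∈ F, C ⊆ W
  disjoint_barrier : ∀ C ∈ F, Disjoint C S
  odd_card : ∀ C ∈ F, Odd #C
  closed : ∀ C ∈ F, ∀ x ∈ C, ∀ y ∈ W, G.Adj x y → y ∈ C ∨ y ∈ S
  pairwiseDisjoint : (F : Set (Finset V)).PairwiseDisjoint id
  card_add_two_le : #S + 2 ≤ #F

theorem add_two_le_of_isTutteViolator [Finite V] (heven : Even (Nat.card V)) {u : Set V}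
    (hu : G.IsTutteViolator u) :
    u.ncard + 2 ≤ ((⊤ : G.Subgraph).deleteVerts u).coe.oddComponents.ncard := by
  have hverts : ((⊤ : G.Subgraph).deleteVerts u).verts = uᶜ := by ext; simp
  have hcard := Set.ncard_add_ncard_compl u
  have hodd := ((⊤ : G.Subgraph).deleteVerts u).coe.odd_ncard_oddComponents
  rw [← hverts] at hcard
  rw [Nat.card_coe_set_eq] at hodd
  unfold SimpleGraph.IsTutteViolator at hu
  grind

theorem exists_isMatchingOn_univ [Fintype V] {M : G.Subgraph} (hM : M.IsPerfectMatching) :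
    ∃ m, IsMatchingOn G univ m := by
  choose p hp hp' using SimpleGraph.Subgraph.isPerfectMatching_iff.1 hM
  exact ⟨p, fun v => (hp' _ _ (hp v).symm).symm, fun v _ => M.adj_sub (hp v), by simp⟩

open Classical in
/-- The vertices of a component of `G - u`, as a set of vertices of `G`. -/
noncomputable def componentFinset [Fintype V] {u : Set V}
    (c : ((⊤ : G.Subgraph).deleteVerts u).coe.ConnectedComponent) : Finset V :=
  c.supp.toFinset.map (Function.Embedding.subtype _)

theorem mem_componentFinset [Fintype V] {u : Set V}
    {c : ((⊤ : G.Subgraph).deleteVerts u).coe.ConnectedComponent} {v : V} :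
    v ∈ componentFinset c ↔ ∃ z ∈ c.supp, (z : V) = v := by
  simp [componentFinset]

theorem eq_of_mem_componentFinset [Fintype V] {u : Set V}
    {c d : ((⊤ : G.Subgraph).deleteVerts u).coe.ConnectedComponent} {v : V}
    (hc : v ∈ componentFinset c) (hd : v ∈ componentFinset d) : c = d := by
  obtain ⟨z, hz, rfl⟩ := mem_componentFinset.1 hc
  obtain ⟨z', hz', h⟩ := mem_componentFinset.1 hd
  rw [Subtype.ext h] at hz'
  exact hz.symm.trans hz'

theorem componentFinset_injective [Fintype V] (u : Set V) :
    Function.Injective (componentFinset (G := G) (u := u)) := by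
  intro c d h
  obtain ⟨z, hz⟩ := c.nonempty_supp
  have hmem : (z : V) ∈ componentFinset c := mem_componentFinset.2 ⟨z, hz, rfl⟩
  exact eq_of_mem_componentFinset hmem (h ▸ hmem)

theorem mem_componentFinset_of_adj [Fintype V] {u : Set V}
    {c : ((⊤ : G.Subgraph).deleteVerts u).coe.ConnectedComponent} {v w : V}
    (hv : v ∈ componentFinset c) (hw : w ∉ u) (h : G.Adj v w) : w ∈ componentFinset c := by
  obtain ⟨z, hz, rfl⟩ := mem_componentFinset.1 hv
  refine mem_componentFinset.2 ⟨⟨w, by simpa using hw⟩, ?_, rfl⟩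
  have hzu : (z : V) ∉ u := z.2.2
  exact SimpleGraph.ConnectedComponent.mem_supp_of_adj_mem_supp _ hz (by simp [hzu, hw, h])

theorem exists_isTutteFamily_univ [Fintype V] (heven : Even (Nat.card V))
    (h : ¬ ∃ m, IsMatchingOn G univ m) : ∃ S F, IsTutteFamily G univ S F := by
  classical
  obtain ⟨u, hu⟩ := SimpleGraph.exists_isTutteViolator
    (fun M hM => h (exists_isMatchingOn_univ hM)) heven
  let odd := ((⊤ : G.Subgraph).deleteVerts u).coe.oddComponents.toFinset
  refine ⟨u.toFinset, odd.map ⟨componentFinset, componentFinset_injective u⟩,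
    subset_univ _, fun _ _ => subset_univ _, ?_, ?_, ?_, ?_, ?_⟩
  · simp only [forall_mem_map, Function.Embedding.coeFn_mk]
    intro c _
    rw [disjoint_left]
    intro v hv hvu
    obtain ⟨z, -, rfl⟩ := mem_componentFinset.1 hv
    exact z.2.2 (Set.mem_toFinset.1 hvu)
  · simp only [forall_mem_map, Function.Embedding.coeFn_mk]
    intro c hc
    have hc : c ∈ ((⊤ : G.Subgraph).deleteVerts u).coe.oddComponents := Set.mem_toFinset.1 hc
    rwa [componentFinset, card_map, ← Set.ncard_eq_toFinset_card']
  · simp only [forall_mem_map, Function.Embedding.coeFn_mk]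
    intro c _ x hx y _ hxy
    by_cases hy : y ∈ u
    · exact Or.inr (Set.mem_toFinset.2 hy)
    · exact Or.inl (mem_componentFinset_of_adj hx hy hxy)
  · rw [coe_map]
    rintro - ⟨c, -, rfl⟩ - ⟨d, -, rfl⟩ hne
    exact disjoint_left.2 fun v hc hd => hne (by rw [eq_of_mem_componentFinset hc hd])
  · rw [card_map, ← Set.ncard_eq_toFinset_card', ← Set.ncard_eq_toFinset_card']
    exact add_two_le_of_isTutteViolator heven hu

theorem IsMatchingOn.of_induce [DecidableEq V] {W : Finset V}
    {m : ↥(W : Set V) → ↥(W : Set V)}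
    (hm : IsMatchingOn (G.induce (W : Set V)) univ m) :
    IsMatchingOn G W fun v => if hv : v ∈ W then (m ⟨v, hv⟩ : V) else v := by
  refine ⟨fun v => ?_, fun v hv => ?_, fun v hv => dif_neg hv⟩
  · by_cases hv : v ∈ W
    · have hmv : (m ⟨v, hv⟩ : V) ∈ W := (m ⟨v, hv⟩).2
      simp [hv, hmv, hm.involutive _]
    · simp [hv]
  · simpa [hv] using hm.adj ⟨v, hv⟩ (mem_univ _)

theorem IsTutteFamily.of_induce {W : Finset V} {S : Finset (W : Set V)}
    {F : Finset (Finset (W : Set V))} (h : IsTutteFamily (G.induce (W : Set V)) univ S F) :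
    IsTutteFamily G W (S.map (Function.Embedding.subtype _))
      (F.map (mapEmbedding (Function.Embedding.subtype _)).toEmbedding) := by
  have hsub : ∀ C : Finset (W : Set V), C.map (Function.Embedding.subtype _) ⊆ W := by
    intro C v hv
    obtain ⟨w, -, rfl⟩ := mem_map.1 hv
    exact w.2
  refine ⟨hsub S, ?_, ?_, ?_, ?_, ?_, ?_⟩
  · simp only [forall_mem_map]
    exact fun C _ => hsub C
  · simp only [forall_mem_map]
    exact fun C hC => (disjoint_map _).2 (h.disjoint_barrier C hC)
  · simp only [forall_mem_map]
    exact fun C hC => (card_map (Function.Embedding.subtype (· ∈ (W : Set V)))).symm ▸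
      h.odd_card C hC
  · simp only [forall_mem_map]
    intro C hC x hxC y hy hxy
    obtain ⟨x, hx, rfl⟩ := mem_map.1 hxC
    refine (h.closed C hC x hx ⟨y, hy⟩ (mem_univ _) hxy).imp (fun hyC => ?_) fun hyS => ?_
    · exact mem_map.2 ⟨_, hyC, rfl⟩
    · exact mem_map.2 ⟨_, hyS, rfl⟩
  · rw [coe_map]
    rintro - ⟨C, hC, rfl⟩ - ⟨D, hD, rfl⟩ hne
    exact (disjoint_map _).2 (h.pairwiseDisjoint hC hD fun hCD => hne (by rw [hCD]))
  · rw [card_map, card_map]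
    exact h.card_add_two_le

theorem exists_isTutteFamily [Finite V] {W : Finset V} (heven : Even #W)
    (h : ¬ ∃ m, IsMatchingOn G W m) :
    ∃ S F, IsTutteFamily G W S F := by
  classical
  have := Fintype.ofFinite V
  obtain ⟨S, F, hF⟩ := exists_isTutteFamily_univ (G := G.induce (W : Set V))
    (by simpa using heven) fun ⟨m, hm⟩ => h ⟨_, hm.of_induce⟩
  exact ⟨_, _, hF.of_induce⟩

end Tutte

section TightFamily

variable {V : Type*} {G Q : SimpleGraph V} {A C S W X : Finset V} {F : Finset (Finset V)}
  {a b c t : V} {m : V → V}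

theorem exists_isTutteFamily_deleteEdges [Finite V] (hm : IsUniqueMatchingOn G W m) (ha : a ∈ W) :
    ∃ S F, IsTutteFamily (G.deleteEdges {s(a, m a)}) W S F := by
  refine exists_isTutteFamily hm.isMatchingOn.even_card fun ⟨n, hn⟩ => ?_
  obtain rfl := hm.eq_of_isMatchingOn n (hn.mono (G.deleteEdges_le _))
  simpa [SimpleGraph.deleteEdges_adj] using hn.adj a ha

variable [DecidableEq V]

theorem IsTutteFamily.edgeCount_eq_zero (hF : IsTutteFamily G W S F) (hC : C ∈ F) :
    edgeCount G C (W \ (S ∪ C)) = 0 := by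
  rw [edgeCount_eq_zero_iff]
  intro x hx y hy hxy
  simp only [mem_sdiff, mem_union, not_or] at hy
  exact (hF.closed C hC x hx y hy.1 hxy).elim hy.2.2 hy.2.1

theorem IsTutteFamily.sum_edgeCount_le_two
    (hF : IsTutteFamily (G.deleteEdges {s(a, b)}) W S F) :
    ∑ C ∈ F, edgeCount G C (W \ (S ∪ C)) ≤ 2 := by
  classical
  have hdisj : (F : Set (Finset V)).PairwiseDisjoint fun C => G.interedges C (W \ (S ∪ C)) :=
    fun C hC D hD hne => disjoint_left.2 fun p hp hp' => disjoint_left.1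
      (hF.pairwiseDisjoint hC hD hne) (G.mem_interedges_iff.1 hp).1 (G.mem_interedges_iff.1 hp').1
  simp only [edgeCount]
  rw [← card_biUnion hdisj]
  refine (card_le_card (t := {(a, b), (b, a)}) ?_).trans card_le_two
  rintro ⟨x, y⟩ hxy
  obtain ⟨C, hC, hxy⟩ := mem_biUnion.1 hxy
  obtain ⟨hx, hy, hadj⟩ := G.mk_mem_interedges_iff.1 hxy
  simp only [mem_sdiff, mem_union, not_or] at hy
  have hdel : ¬ (G.deleteEdges {s(a, b)}).Adj x y := fun h =>
    (hF.closed C hC x hx y hy.1 h).elim hy.2.2 hy.2.1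
  simpa [SimpleGraph.deleteEdges_adj, hadj, or_iff_not_imp_left] using hdel

variable [Fintype V]

theorem boundary_le_add_edgeCount (hS : S ⊆ W) (C : Finset V) :
    boundary G C ≤ edgeCount G C S + edgeCount G C Wᶜ + edgeCount G C (W \ (S ∪ C)) := by
  have hsub : Cᶜ ⊆ S ∪ Wᶜ ∪ W \ (S ∪ C) := by
    intro v
    simp only [mem_compl, mem_union, mem_sdiff]
    tauto
  have hSW : Disjoint S Wᶜ := disjoint_compl_right.mono_left hS
  have hrest : Disjoint (S ∪ Wᶜ) (W \ (S ∪ C)) := disjoint_union_left.2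
    ⟨disjoint_sdiff.mono_left subset_union_left, disjoint_compl_left.mono_right sdiff_subset⟩
  rw [← edgeCount_union_right hSW, ← edgeCount_union_right hrest]
  exact edgeCount_mono subset_rfl hsub

theorem IsTutteFamily.sum_boundary_le (hF : IsTutteFamily Q W S F) (G : SimpleGraph V) :
    ∑ C ∈ F, boundary G C ≤
      edgeCount G S univ + boundary G W + ∑ C ∈ F, edgeCount G C (W \ (S ∪ C)) := by
  have hsum (Z : Finset V) : ∑ C ∈ F, edgeCount G C Z = edgeCount G (F.biUnion id) Z :=
    (edgeCount_biUnion_left hF.pairwiseDisjoint Z).symm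
  have hS : edgeCount G (F.biUnion id) S ≤ edgeCount G S univ :=
    edgeCount_comm S _ ▸ edgeCount_mono subset_rfl (subset_univ _)
  have hW : edgeCount G (F.biUnion id) Wᶜ ≤ boundary G W :=
    edgeCount_mono (biUnion_subset.2 hF.subset) subset_rfl
  have hle := sum_le_sum fun C (_ : C ∈ F) => boundary_le_add_edgeCount (G := G) hF.barrier_subset C
  simp only [sum_add_distrib, hsum] at hle
  omega

/-- A cubic simple graph in which at least three edges leave every proper nonempty set of
vertices. -/
structure IsCubic3EdgeConnected (G : SimpleGraph V) : Prop where
  edgeCount_singleton_univ : ∀ v, edgeCount G {v} univ = 3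
  three_le_boundary : ∀ X : Finset V, X.Nonempty → Xᶜ.Nonempty → 3 ≤ boundary G X

namespace IsCubic3EdgeConnected

theorem edgeCount_univ (hG : IsCubic3EdgeConnected G) (X : Finset V) :
    edgeCount G X univ = 3 * #X := by
  rw [edgeCount_eq_sum, sum_congr rfl fun x _ => hG.edgeCount_singleton_univ x, sum_const,
    smul_eq_mul, mul_comm]

theorem boundary_singleton (hG : IsCubic3EdgeConnected G) (x : V) : boundary G {x} = 3 :=
  (LonelyEdge.boundary_singleton x).trans (hG.edgeCount_singleton_univ x)

theorem edgeCount_self_add_boundary (hG : IsCubic3EdgeConnected G) (X : Finset V) :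
    edgeCount G X X + boundary G X = 3 * #X := by
  rw [boundary, edgeCount_add_edgeCount_compl, hG.edgeCount_univ]

theorem odd_boundary_iff (hG : IsCubic3EdgeConnected G) : Odd (boundary G X) ↔ Odd #X := by
  have hcount := hG.edgeCount_self_add_boundary X
  have heven := even_edgeCount_self (G := G) X
  grind

theorem three_le_boundary_of_mem (hG : IsCubic3EdgeConnected G) (hF : IsTutteFamily Q W S F)
    (hW : Wᶜ.Nonempty) : ∀ C ∈ F, 3 ≤ boundary G C := fun C hC =>
  hG.three_le_boundary C (card_pos.1 (hF.odd_card C hC).pos)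
    (hW.mono (compl_subset_compl.2 (hF.subset C hC)))

theorem three_mul_card_le (hG : IsCubic3EdgeConnected G) (hF : IsTutteFamily Q W S F)
    (hW : Wᶜ.Nonempty) :
    3 * #F ≤ 3 * #S + boundary G W + ∑ C ∈ F, edgeCount G C (W \ (S ∪ C)) := by
  have hsum := hF.sum_boundary_le G
  rw [hG.edgeCount_univ] at hsum
  refine le_trans ?_ hsum
  rw [mul_comm, ← smul_eq_mul]
  exact card_nsmul_le_sum _ _ _ (hG.three_le_boundary_of_mem hF hW)

theorem exists_isMatchingOn (hG : IsCubic3EdgeConnected G) (heven : Even #W)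
    (hW : boundary G W ≤ 4) (hne : Wᶜ.Nonempty) : ∃ m, IsMatchingOn G W m := by
  by_contra hno
  obtain ⟨S, F, hF⟩ := exists_isTutteFamily heven hno
  have hcount := hG.three_mul_card_le hF hne
  rw [sum_eq_zero fun C hC => hF.edgeCount_eq_zero hC] at hcount
  have := hF.card_add_two_le
  omega

theorem exists_isMatchingOn_erase (hG : IsCubic3EdgeConnected G) (hA : boundary G A = 3)
    (hc : c ∈ A) (ht : t ∉ A) (h : G.Adj c t) : ∃ n, IsMatchingOn G (A.erase c) n := by
  have herase := boundary_erase (G := G) hc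
  have hexit := edgeCount_pos (mem_singleton_self c) (mem_compl.2 ht) h
  have hodd : Odd #A := hG.odd_boundary_iff.1 (by rw [hA]; decide)
  rw [hA, hG.boundary_singleton] at herase
  refine hG.exists_isMatchingOn ?_ (by omega) ⟨c, by simp⟩
  rw [card_erase_of_mem hc]
  exact Nat.Odd.sub_odd hodd odd_one

/-- Every inequality in the count behind `exists_isMatchingOn` becomes tight here, because deleting
one edge of `G` leaves a slack of exactly two. -/
theorem boundary_eq_three (hG : IsCubic3EdgeConnected G)
    (hF : IsTutteFamily (G.deleteEdges {s(a, b)}) W S F) (hW : boundary G W = 4) (hC : C ∈ F) :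
    boundary G C = 3 := by
  have hne : Wᶜ.Nonempty := by
    by_contra! h
    simp [boundary, h, edgeCount_empty_right] at hW
  have hge := hG.three_le_boundary_of_mem hF hne
  have hsum := hF.sum_boundary_le G
  have hexcess := hF.sum_edgeCount_le_two
  have hcard := hF.card_add_two_le
  rw [hG.edgeCount_univ] at hsum
  have hle : ∑ C ∈ F, boundary G C ≤ ∑ _C ∈ F, 3 := by
    rw [sum_const, smul_eq_mul]
    omega
  exact ((sum_eq_sum_iff_of_le hge).1 (le_antisymm (sum_le_sum hge) hle) C hC).symm

end IsCubic3EdgeConnected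

end TightFamily

section Kotzig

variable {V : Type*} {G : SimpleGraph V} {A C S W : Finset V} {F : Finset (Finset V)}
  {a b c t x y : V} {m : V → V}

theorem exists_finset_bijOn {α : Type*} [Finite α] [Nonempty α] (g : α → α) :
    ∃ P : Finset α, P.Nonempty ∧ Set.BijOn g P P := by
  classical
  have := Fintype.ofFinite α
  refine ⟨(Function.periodicPts g).toFinset, ?_, by simpa using Function.bijOn_periodicPts g⟩
  obtain ⟨i, j, hij, h⟩ := Finite.exists_ne_map_eq_of_infinite
    fun n : ℕ => g^[n] (Classical.arbitrary α)
  wlog hlt : i < j generalizing i j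
  · exact this j i hij.symm h.symm (by omega)
  refine ⟨g^[i] (Classical.arbitrary α), Set.mem_toFinset.2 ?_⟩
  refine Function.mk_mem_periodicPts (n := j - i) (by omega) ?_
  rw [Function.IsPeriodicPt, Function.IsFixedPt, ← Function.iterate_add_apply,
    Nat.sub_add_cancel hlt.le]
  exact h.symm

theorem exists_isMatchingOn_insert [DecidableEq V] (hc : c ∈ A) (ht : t ∉ A) (h : G.Adj c t)
    (hn : ∃ n, IsMatchingOn G (A.erase c) n) :
    ∃ n, IsMatchingOn G (insert t A) n ∧ n c = t := by
  obtain ⟨n, hn⟩ := hn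
  have htc : t ∉ A.erase c := fun htA => ht (mem_of_mem_erase htA)
  have hmatch := hn.insert_insert (notMem_erase c A) htc h
  rw [Finset.insert_comm, insert_erase hc] at hmatch
  exact ⟨_, hmatch, by simp [hn.apply_of_notMem t htc]⟩

/-- Following the edges from `c i` to `m (x (g i))` around a cycle of `g` rotates the matching `m`
to another perfect matching, unless these edges already belong to `m`. -/
theorem IsUniqueMatchingOn.exists_eq_exit [DecidableEq V] {ι : Type*} [Finite ι] [Nonempty ι]
    {C : ι → Finset V} {x c : ι → V} {g : ι → ι} (hm : IsUniqueMatchingOn G W m)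
    (hdisj : Pairwise fun i j => Disjoint (C i) (C j)) (hsub : ∀ i, C i ⊆ W)
    (hx : ∀ i, x i ∈ C i) (hout : ∀ i j, m (x i) ∉ C j)
    (hexit : ∀ i, ∀ v ∈ C i, m v ∉ C i → v = x i) (hc : ∀ i, c i ∈ C i)
    (hadj : ∀ i, G.Adj (c i) (m (x (g i))))
    (hn : ∀ i, ∃ n, IsMatchingOn G ((C i).erase (c i)) n) : ∃ i, g i = i ∧ c i = x i := by
  have hinvol := hm.isMatchingOn.involutive
  have hindex {i j v} (hi : v ∈ C i) (hj : v ∈ C j) : i = j := by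
    by_contra hij
    exact disjoint_left.1 (hdisj hij) hi hj
  obtain ⟨P, ⟨i₀, hi₀⟩, hP⟩ := exists_finset_bijOn g
  choose n hn hnc using fun i => exists_isMatchingOn_insert (hc i) (hout (g i) i) (hadj i) (hn i)
  have hpieces : (P : Set ι).PairwiseDisjoint fun i => insert (m (x (g i))) (C i) := by
    intro i hi j hj hij
    have hne : m (x (g i)) ≠ m (x (g j)) := fun h => hij <| hP.injOn hi hj <|
      hindex (hx (g i)) (hinvol.injective h ▸ hx (g j))
    simp only [Function.onFun, disjoint_insert_left, disjoint_insert_right, mem_insert, hout,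
      hdisj hij, hne.symm, or_false, not_false_eq_true, and_self]
  obtain ⟨m', hm', hm'n⟩ := exists_isMatchingOn_biUnion hpieces fun i _ => hn i
  have hunion : P.biUnion (fun i => insert (m (x (g i))) (C i)) ⊆ W := biUnion_subset.2 fun i _ =>
    insert_subset (hm.isMatchingOn.apply_mem (hsub _ (hx _))) (hsub i)
  have hinv : ∀ v ∈ P.biUnion (fun i => insert (m (x (g i))) (C i)),
      m v ∈ P.biUnion fun i => insert (m (x (g i))) (C i) := by
    simp only [mem_biUnion, mem_insert]
    rintro v ⟨i, hi, rfl | hv⟩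
    · exact ⟨g i, hP.mapsTo hi, .inr (by rw [hinvol]; exact hx (g i))⟩
    by_cases hmv : m v ∈ C i
    · exact ⟨i, hi, .inr hmv⟩
    · obtain ⟨j, hj, rfl⟩ := hP.surjOn hi
      exact ⟨j, hj, .inl (by rw [hexit _ v hv hmv])⟩
  have hci : c i₀ ∈ insert (m (x (g i₀))) (C i₀) := mem_insert_of_mem (hc i₀)
  have hmc : m (c i₀) = m (x (g i₀)) := by
    rw [← hm.eqOn hunion hinv hm' (mem_biUnion.2 ⟨i₀, hi₀, hci⟩), hm'n i₀ hi₀ _ hci, hnc]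
  have hcx : c i₀ = x (g i₀) := hinvol.injective hmc
  have hg : g i₀ = i₀ := hindex (hcx ▸ hx (g i₀)) (hc i₀)
  exact ⟨i₀, hg, by rw [hcx, hg]⟩

/-- The members of `F` that contain neither `a` nor `b`. -/
abbrev avoiding [DecidableEq V] (F : Finset (Finset V)) (a b : V) : Finset (Finset V) :=
  {C ∈ F | a ∉ C ∧ b ∉ C}

namespace IsTutteFamily

theorem mem_barrier_of_adj (hF : IsTutteFamily (G.deleteEdges {s(a, b)}) W S F) (hC : C ∈ F)
    (ha : a ∉ C) (hb : b ∉ C) (hx : x ∈ C) (hyW : y ∈ W) (hyC : y ∉ C) (h : G.Adj x y) :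
    y ∈ S := by
  refine (hF.closed C hC x hx y hyW ?_).resolve_left hyC
  rw [SimpleGraph.deleteEdges_adj, Set.mem_singleton_iff, Sym2.eq_iff]
  exact ⟨h, by rintro (⟨rfl, -⟩ | ⟨rfl, -⟩) <;> contradiction⟩

theorem eq_of_mem_of_mem (hF : IsTutteFamily G W S F) {D : Finset V} (hC : C ∈ F) (hD : D ∈ F)
    (hxC : x ∈ C) (hxD : x ∈ D) : C = D :=
  hF.pairwiseDisjoint.elim_finset hC hD x hxC hxD

theorem exists_apply_mem_barrier (hF : IsTutteFamily (G.deleteEdges {s(a, b)}) W S F)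
    (hm : IsMatchingOn G W m) (hC : C ∈ F) (ha : a ∉ C) (hb : b ∉ C) : ∃ x ∈ C, m x ∈ S := by
  classical
  by_contra! hno
  have hinv : ∀ v ∈ C, m v ∈ C := by
    intro v hv
    by_contra hmv
    have hvW := hF.subset C hC hv
    exact hno v hv (hF.mem_barrier_of_adj hC ha hb hv (hm.apply_mem hvW) hmv (hm.adj v hvW))
  exact Nat.not_even_iff_odd.2 (hF.odd_card C hC)
    (hm.restrict (hF.subset C hC) hinv).even_card

variable [DecidableEq V]

theorem card_filter_mem_le_one (hF : IsTutteFamily G W S F) (v : V) : #{C ∈ F | v ∈ C} ≤ 1 := by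
  simp only [card_le_one, mem_filter]
  exact fun C hC D hD => hF.eq_of_mem_of_mem hC.1 hD.1 hC.2 hD.2

theorem card_barrier_le (hF : IsTutteFamily G W S F) (a b : V) :
    #S ≤ #(avoiding F a b) := by
  have hcover : F ⊆ avoiding F a b ∪ ({C ∈ F | a ∈ C} ∪ {C ∈ F | b ∈ C}) := by
    intro C hC
    simp only [mem_union, mem_filter]
    tauto
  have hle := (card_le_card hcover).trans (card_union_le _ _)
  have hle' := card_union_le {C ∈ F | a ∈ C} {C ∈ F | b ∈ C}
  have ha := hF.card_filter_mem_le_one a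
  have hb := hF.card_filter_mem_le_one b
  have := hF.card_add_two_le
  omega

/-- There are at most as many barrier vertices as members avoiding `a` and `b`, so the matching
edges leaving these members use up the whole barrier. -/
theorem exists_exits (hF : IsTutteFamily (G.deleteEdges {s(a, b)}) W S F)
    (hm : IsMatchingOn G W m) :
    ∃ x : avoiding F a b → V, (∀ C, x C ∈ C.1 ∧ m (x C) ∈ S) ∧
      ∀ s ∈ S, ∃ C, m (x C) = s := by
  have hF' (C : avoiding F a b) := mem_filter.1 C.2
  choose x hx hxS using fun C : avoiding F a b =>
    hF.exists_apply_mem_barrier hm (hF' C).1 (hF' C).2.1 (hF' C).2.2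
  let s (C : avoiding F a b) : S := ⟨m (x C), hxS C⟩
  have hinj : Function.Injective s := by
    intro C D h
    have hxCD : x C = x D := hm.involutive.injective (congrArg Subtype.val h)
    exact Subtype.ext (hF.eq_of_mem_of_mem (hF' C).1 (hF' D).1 (hx C) (hxCD ▸ hx D))
  have hcard : Fintype.card S ≤ Fintype.card (avoiding F a b) := by
    simpa only [Fintype.card_coe] using hF.card_barrier_le a b
  have hsurj := ((Fintype.bijective_iff_injective_and_card s).2
    ⟨hinj, (Fintype.card_le_of_injective s hinj).antisymm hcard⟩).2
  refine ⟨x, fun C => ⟨hx C, hxS C⟩, fun t ht => ?_⟩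
  obtain ⟨C, hC⟩ := hsurj ⟨t, ht⟩
  exact ⟨C, congrArg Subtype.val hC⟩

theorem eq_exit (hF : IsTutteFamily (G.deleteEdges {s(a, b)}) W S F) (hm : IsMatchingOn G W m)
    {x : avoiding F a b → V} (hx : ∀ C, x C ∈ C.1) (hsurj : ∀ s ∈ S, ∃ C, m (x C) = s)
    {C : avoiding F a b} (hy : y ∈ C.1) (hmy : m y ∉ C.1) : y = x C := by
  obtain ⟨hC, ha, hb⟩ := mem_filter.1 C.2
  have hyW := hF.subset C hC hy
  obtain ⟨D, hD⟩ := hsurj _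
    (hF.mem_barrier_of_adj hC ha hb hy (hm.apply_mem hyW) hmy (hm.adj y hyW))
  obtain rfl : x D = y := hm.involutive.injective hD
  rw [Subtype.ext (hF.eq_of_mem_of_mem hC (mem_filter.1 D.2).1 hy (hx D))]

end IsTutteFamily

variable [Fintype V] [DecidableEq V]

/-- The matching edge from `a` to `m a` is the only edge between `A` and `W \ A`, and three edges
of `G` leave `A`. -/
structure IsBridgeSide (G : SimpleGraph V) (W : Finset V) (m : V → V) (A : Finset V) (a : V) :
    Prop where
  subset : A ⊆ W
  mem : a ∈ A
  apply_mem : m a ∈ W \ A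
  boundary_eq : boundary G A = 3
  eq_of_adj : ∀ x ∈ A, ∀ y ∈ W \ A, G.Adj x y → x = a ∧ y = m a

theorem IsTutteFamily.isBridgeSide (hF : IsTutteFamily (G.deleteEdges {s(a, m a)}) W ∅ F)
    (hm : IsMatchingOn G W m) (ha : a ∈ W) (hC : C ∈ F) (hCa : boundary G C = 3) (haC : a ∈ C)
    (hmaC : m a ∉ C) : IsBridgeSide G W m C a := by
  refine ⟨hF.subset C hC, haC, mem_sdiff.2 ⟨hm.apply_mem ha, hmaC⟩, hCa, fun x hx y hy hxy => ?_⟩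
  rw [mem_sdiff] at hy
  have hedge : s(x, y) = s(a, m a) := by
    by_contra hne
    have := hF.closed C hC x hx y hy.1 (SimpleGraph.deleteEdges_adj.2 ⟨hxy, hne⟩)
    simp [hy.2] at this
  obtain h | ⟨rfl, -⟩ := Sym2.eq_iff.1 hedge
  · exact h
  · contradiction

theorem IsTutteFamily.exists_second_exit
    (hF : IsTutteFamily (G.deleteEdges {s(a, b)}) W S F) {x : avoiding F a b → V}
    (hx : ∀ C, x C ∈ C.1 ∧ m (x C) ∈ S) (hsurj : ∀ s ∈ S, ∃ C, m (x C) = s)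
    (C : avoiding F a b) (hC3 : boundary G C = 3) (hno : ¬ IsBridgeSide G W m C (x C)) :
    ∃ D, ∃ c ∈ C.1, G.Adj c (m (x D)) ∧ ¬ (D = C ∧ c = x C) := by
  obtain ⟨hC, ha, hb⟩ := mem_filter.1 C.2
  have hmx : m (x C) ∈ W \ C.1 := mem_sdiff.2 ⟨hF.barrier_subset (hx C).2,
    disjoint_right.1 (hF.disjoint_barrier C hC) (hx C).2⟩
  by_contra! hall
  refine hno ⟨hF.subset C hC, (hx C).1, hmx, hC3, fun v hv y hy hvy => ?_⟩
  rw [mem_sdiff] at hy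
  obtain ⟨D, rfl⟩ := hsurj y (hF.mem_barrier_of_adj hC ha hb hv hy.1 hy.2 hvy)
  obtain ⟨rfl, hvx⟩ := hall D v hv hvy
  exact ⟨hvx, rfl⟩

namespace IsCubic3EdgeConnected

theorem exists_isBridgeSide_of_forall_mem (hG : IsCubic3EdgeConnected G)
    (hm : IsMatchingOn G W m) (hW : boundary G W = 4) (ha : a ∈ W)
    (hF : IsTutteFamily (G.deleteEdges {s(a, m a)}) W S F)
    (hmem : ∀ C ∈ F, a ∈ C ∨ m a ∈ C) : ∃ A b, IsBridgeSide G W m A b := by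
  obtain rfl : S = ∅ := by
    rw [← card_eq_zero, ← Nat.le_zero]
    refine (hF.card_barrier_le a (m a)).trans_eq (card_eq_zero.2 (filter_eq_empty_iff.2 ?_))
    exact fun C hC => by simpa [or_iff_not_imp_left] using hmem C hC
  have htwo : 1 < #F := by simpa [Nat.succ_le_iff] using hF.card_add_two_le
  obtain ⟨C, hC, D, hD, hCD⟩ := one_lt_card.1 htwo
  have hnot : ∀ v ∈ C, v ∉ D := fun v hvC hvD => hCD (hF.eq_of_mem_of_mem hC hD hvC hvD)
  have hC3 := hG.boundary_eq_three hF hW hC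
  obtain haC | hmaC := hmem C hC
  · refine ⟨C, a, hF.isBridgeSide hm ha hC hC3 haC fun hmaC => ?_⟩
    exact (hmem D hD).elim (hnot _ haC) (hnot _ hmaC)
  · have hmma : m (m a) = a := hm.involutive a
    refine ⟨C, m a, IsTutteFamily.isBridgeSide (by rwa [hmma, Sym2.eq_swap]) hm (hm.apply_mem ha)
      hC hC3 hmaC fun haC => ?_⟩
    rw [hmma] at haC
    exact (hmem D hD).elim (hnot _ haC) (hnot _ hmaC)

/-- Kotzig's theorem on unique perfect matchings, for vertex sets with four leaving edges. -/
theorem exists_isBridgeSide (hG : IsCubic3EdgeConnected G) (hm : IsUniqueMatchingOn G W m)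
    (hW : boundary G W = 4) (hne : W.Nonempty) : ∃ A a, IsBridgeSide G W m A a := by
  obtain ⟨a, ha⟩ := hne
  obtain ⟨S, F, hF⟩ := exists_isTutteFamily_deleteEdges hm ha
  have hmatch := hm.isMatchingOn
  obtain hempty | ⟨C₀, hC₀⟩ := (avoiding F a (m a)).eq_empty_or_nonempty
  · refine hG.exists_isBridgeSide_of_forall_mem hmatch hW ha hF fun C hC => ?_
    simpa [or_iff_not_imp_left] using filter_eq_empty_iff.1 hempty hC
  have : Nonempty (avoiding F a (m a)) := ⟨⟨C₀, hC₀⟩⟩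
  have hmem (C : avoiding F a (m a)) : C.1 ∈ F := (mem_filter.1 C.2).1
  have hthree (C : avoiding F a (m a)) := hG.boundary_eq_three hF hW (hmem C)
  obtain ⟨x, hx, hsurj⟩ := hF.exists_exits hmatch
  have hout (C D : avoiding F a (m a)) : m (x C) ∉ D.1 :=
    disjoint_right.1 (hF.disjoint_barrier D (hmem D)) (hx C).2
  by_contra! hno
  choose g c hc hadj hgc using fun C =>
    hF.exists_second_exit hx hsurj C (hthree C) (hno C (x C))
  obtain ⟨C, hC⟩ := hm.exists_eq_exit (C := Subtype.val)
    (fun C D h => hF.pairwiseDisjoint (hmem C) (hmem D) (Subtype.coe_ne_coe.2 h))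
    (fun C => hF.subset C (hmem C)) (fun C => (hx C).1) hout
    (fun C y hy hmy => hF.eq_exit hmatch (fun C => (hx C).1) hsurj hy hmy) hc hadj
    fun C => hG.exists_isMatchingOn_erase (hthree C) (hc C) (hout _ C) (hadj C)
  exact hgc C hC

end IsCubic3EdgeConnected

end Kotzig

section Triangle

variable {V : Type*} [Fintype V] [DecidableEq V] {G : SimpleGraph V} {A W : Finset V}
  {a t t' u v x y z : V} {m n : V → V}

theorem boundary_compl (X : Finset V) : boundary G Xᶜ = boundary G X := by
  rw [boundary, boundary, compl_compl, edgeCount_comm]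

namespace IsCubic3EdgeConnected

theorem odd_card_of_boundary_eq_three (hG : IsCubic3EdgeConnected G) (hA : boundary G A = 3) :
    Odd #A :=
  hG.odd_boundary_iff.1 (hA ▸ by decide)

theorem edgeCount_compl_le_one (hG : IsCubic3EdgeConnected G) (hA : boundary G A = 3)
    (hx : x ∈ A) (hcard : 2 ≤ #A) : edgeCount G {x} Aᶜ ≤ 1 := by
  have herase := boundary_erase (G := G) hx
  have hne : (A.erase x).Nonempty := card_pos.1 (by rw [card_erase_of_mem hx]; omega)
  have hge := hG.three_le_boundary _ hne ⟨x, by simp⟩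
  rw [hA, hG.boundary_singleton] at herase
  omega

theorem card_le_one_of_adj_of_adj (hG : IsCubic3EdgeConnected G) (hA : boundary G A = 3)
    (hx : x ∈ A) (hy : y ∉ A) (hz : z ∉ A) (hyz : y ≠ z) (hxy : G.Adj x y) (hxz : G.Adj x z) :
    #A ≤ 1 := by
  by_contra! hlt
  have hle := hG.edgeCount_compl_le_one hA hx hlt
  have := two_le_edgeCount (mem_compl.2 hy) (mem_compl.2 hz) hyz hxy hxz
  omega

theorem boundary_erase_eq_four (hG : IsCubic3EdgeConnected G) (hA : boundary G A = 3)
    (hx : x ∈ A) (hcard : 2 ≤ #A) (hy : y ∉ A) (h : G.Adj x y) : boundary G (A.erase x) = 4 := by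
  have herase := boundary_erase (G := G) hx
  have hle := hG.edgeCount_compl_le_one hA hx hcard
  have hpos := edgeCount_pos (mem_singleton_self x) (mem_compl.2 hy) h
  rw [hA, hG.boundary_singleton] at herase
  omega

theorem edgeCount_singleton_le_one (hG : IsCubic3EdgeConnected G) (hA : boundary G A = 3)
    (hx : x ∉ A) (hy : y ∉ A) (hyx : y ≠ x) : edgeCount G {x} A ≤ 1 := by
  have hunion := boundary_union (G := G) (disjoint_singleton_left.2 hx)
  have hge := hG.three_le_boundary ({x} ∪ A) ⟨x, by simp⟩ ⟨y, by simp [hy, hyx]⟩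
  rw [hA, hG.boundary_singleton] at hunion
  omega

theorem isClique_of_card_eq_three (hG : IsCubic3EdgeConnected G) (hA : boundary G A = 3)
    (hcard : #A = 3) : G.IsClique A := by
  classical
  have hsub : G.interedges A A ⊆ A.offDiag := fun ⟨x, y⟩ hxy => by
    obtain ⟨hx, hy, hadj⟩ := G.mk_mem_interedges_iff.1 hxy
    exact mem_offDiag.2 ⟨hx, hy, hadj.ne⟩
  have hcount : #(G.interedges A A) = 6 := by
    have := hG.edgeCount_self_add_boundary A
    unfold edgeCount at this
    convert (by omega : #(G.interedges A A) = 6)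
  have heq : G.interedges A A = A.offDiag :=
    eq_of_subset_of_card_le hsub (by rw [hcount, offDiag_card, hcard])
  intro x hx y hy hxy
  exact (G.mk_mem_interedges_iff.1 (heq ▸ mem_offDiag.2 ⟨hx, hy, hxy⟩)).2.2

theorem boundary_pair (hG : IsCubic3EdgeConnected G) (h : G.Adj u v) : boundary G {u, v} = 4 := by
  have hunion := boundary_union (G := G) (disjoint_singleton.2 h.ne)
  rw [hG.boundary_singleton, hG.boundary_singleton, edgeCount_pair h, ← insert_eq] at hunion
  omega

end IsCubic3EdgeConnected

namespace IsBridgeSide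

theorem adj (h : IsBridgeSide G W m A a) (hm : IsMatchingOn G W m) : G.Adj a (m a) :=
  hm.adj a (h.subset h.mem)

theorem edgeCount_sdiff (h : IsBridgeSide G W m A a) (hm : IsMatchingOn G W m) :
    edgeCount G A (W \ A) = 1 := by
  classical
  rw [edgeCount, card_eq_one]
  refine ⟨(a, m a), ext fun ⟨x, y⟩ => ?_⟩
  rw [G.mk_mem_interedges_iff, mem_singleton, Prod.mk.injEq]
  constructor
  · exact fun ⟨hx, hy, hxy⟩ => h.eq_of_adj x hx y hy hxy
  · rintro ⟨rfl, rfl⟩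
    exact ⟨h.mem, h.apply_mem, h.adj hm⟩

theorem symm (h : IsBridgeSide G W m A a) (hm : IsMatchingOn G W m) (hW : boundary G W = 4) :
    IsBridgeSide G W m (W \ A) (m a) := by
  have hunion := boundary_union (G := G) (disjoint_sdiff : Disjoint A (W \ A))
  rw [union_sdiff_of_subset h.subset, hW, h.boundary_eq, h.edgeCount_sdiff hm] at hunion
  refine ⟨sdiff_subset, h.apply_mem, ?_, by omega, fun x hx y hy hxy => ?_⟩
  · rw [hm.involutive, Finset.sdiff_sdiff_eq_self h.subset]
    exact h.mem
  · rw [Finset.sdiff_sdiff_eq_self h.subset] at hy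
    obtain ⟨rfl, rfl⟩ := h.eq_of_adj y hy x hx hxy.symm
    exact ⟨rfl, (hm.involutive _).symm⟩

theorem exists_isUniqueMatchingOn_erase (h : IsBridgeSide G W m A a)
    (hm : IsUniqueMatchingOn G W m) : ∃ n, IsUniqueMatchingOn G (A.erase a) n := by
  have hmatch := hm.isMatchingOn
  refine ⟨_, hm.restrict ((erase_subset _ _).trans h.subset) fun v hv => ?_⟩
  obtain ⟨hva, hvA⟩ := mem_erase.1 hv
  have hvW := h.subset hvA
  refine mem_erase.2 ⟨fun hmv => ?_, ?_⟩
  · refine (mem_sdiff.1 h.apply_mem).2 ?_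
    rwa [← hmv, hmatch.involutive]
  · by_contra hmvA
    exact hva (h.eq_of_adj v hvA _ (mem_sdiff.2 ⟨hmatch.apply_mem hvW, hmvA⟩)
      (hmatch.adj v hvW)).1

end IsBridgeSide

theorem IsCubic3EdgeConnected.exists_isNClique_three_of_isUniqueMatchingOn
    (hG : IsCubic3EdgeConnected G) (hm : IsUniqueMatchingOn G W m) (hW : boundary G W = 4)
    (hcard : 3 ≤ #W) : ∃ T, G.IsNClique 3 T := by
  induction W using Finset.strongInduction generalizing m with
  | _ W ih =>
  obtain ⟨A, a, hA⟩ := hG.exists_isBridgeSide hm hW (card_pos.1 (by omega))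
  have hmatch := hm.isMatchingOn
  wlog htwo : 2 ≤ #A generalizing A a
  · refine this _ _ (hA.symm hmatch hW) ?_
    have := card_sdiff_add_card_eq_card hA.subset
    omega
  obtain ⟨k, hk⟩ := hG.odd_card_of_boundary_eq_three hA.boundary_eq
  obtain hthree | hfour : #A = 3 ∨ 4 ≤ #A := by omega
  · exact ⟨A, hG.isClique_of_card_eq_three hA.boundary_eq hthree, hthree⟩
  · obtain ⟨n, hn⟩ := hA.exists_isUniqueMatchingOn_erase hm
    refine ih _ ((erase_ssubset hA.mem).trans_subset hA.subset) hn ?_ ?_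
    · exact hG.boundary_erase_eq_four hA.boundary_eq hA.mem htwo (mem_sdiff.1 hA.apply_mem).2
        (hA.adj hmatch)
    · rw [card_erase_of_mem hA.mem]
      omega

/-- The edge `uv` lies in exactly one perfect matching of `G`. -/
def IsLonelyEdge (G : SimpleGraph V) (u v : V) : Prop :=
  G.Adj u v ∧ ∃! m, IsMatchingOn G univ m ∧ m u = v

theorem IsMatchingOn.comp_swap (hn : IsMatchingOn G {u, v}ᶜ n) (h : G.Adj u v) :
    IsMatchingOn G univ (n ∘ Equiv.swap u v) ∧ (n ∘ Equiv.swap u v) u = v := by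
  refine ⟨?_, by simp [hn.apply_of_notMem v]⟩
  have hmatch := hn.insert_insert (by simp) (by simp) h
  rwa [← singleton_union v, ← insert_union, union_compl] at hmatch

theorem IsLonelyEdge.exists_isUniqueMatchingOn (h : IsLonelyEdge G u v) :
    ∃ m, IsUniqueMatchingOn G {u, v}ᶜ m := by
  obtain ⟨hadj, m, ⟨hm, rfl⟩, huniq⟩ := h
  have hinv : ∀ x ∈ ({u, m u}ᶜ : Finset V), m x ∈ ({u, m u}ᶜ : Finset V) := by
    rw [compl_eq_univ_sdiff]
    refine hm.apply_mem_sdiff fun x hx => ?_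
    obtain rfl | rfl : x = u ∨ x = m u := by simpa using hx
    · simp
    · simp [hm.involutive u]
  have hr := hm.restrict (subset_univ _) hinv
  refine ⟨_, hr, fun n hn => (Equiv.swap u (m u)).surjective.injective_comp_right ?_⟩
  exact (huniq _ (hn.comp_swap hadj)).trans (huniq _ (hr.comp_swap hadj)).symm

namespace IsCubic3EdgeConnected

theorem exists_isNClique_three (hG : IsCubic3EdgeConnected G) (h : IsLonelyEdge G u v)
    (hV : 4 < Fintype.card V) : ∃ T, G.IsNClique 3 T := by
  obtain ⟨m, hm⟩ := h.exists_isUniqueMatchingOn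
  refine hG.exists_isNClique_three_of_isUniqueMatchingOn hm ?_ ?_
  · rw [boundary_compl, hG.boundary_pair h.1]
  · rw [card_compl, card_pair h.1.ne]
    omega

theorem not_isLonelyEdge_of_triangle (hG : IsCubic3EdgeConnected G) (hV : 4 < Fintype.card V)
    (hut : G.Adj u t) (hut' : G.Adj u t') (htt' : G.Adj t t') (hvt : v ≠ t) (hvt' : v ≠ t') :
    ¬ IsLonelyEdge G u v := by
  intro h
  obtain ⟨m, hm⟩ := h.exists_isUniqueMatchingOn
  have hmatch := hm.isMatchingOn
  have hW : boundary G {u, v}ᶜ = 4 := by rw [boundary_compl, hG.boundary_pair h.1]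
  have hcard : #({u, v}ᶜ : Finset V) = Fintype.card V - 2 := by rw [card_compl, card_pair h.1.ne]
  obtain ⟨A, a, hA⟩ := hG.exists_isBridgeSide hm hW (card_pos.1 (by omega))
  have htW : t ∈ ({u, v}ᶜ : Finset V) := by simp [hut.ne', hvt.symm]
  have htW' : t' ∈ ({u, v}ᶜ : Finset V) := by simp [hut'.ne', hvt'.symm]
  wlog htA : t ∈ A generalizing A a
  · exact this _ _ (hA.symm hmatch hW) (mem_sdiff.2 ⟨htW, htA⟩)
  have hnot {B b} (hB : IsBridgeSide G {u, v}ᶜ m B b) : u ∉ B ∧ v ∉ B :=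
    ⟨fun hu => by simpa using hB.subset hu, fun hv => by simpa using hB.subset hv⟩
  have htA' : t' ∉ A := fun htA' => by
    have hle := hG.edgeCount_singleton_le_one hA.boundary_eq (hnot hA).1 (hnot hA).2 h.1.ne'
    have := two_le_edgeCount htA htA' htt'.ne hut hut'
    omega
  have hA' := hA.symm hmatch hW
  have hle := hG.card_le_one_of_adj_of_adj hA.boundary_eq htA (hnot hA).1 htA' hut'.ne hut.symm htt'
  have hle' := hG.card_le_one_of_adj_of_adj hA'.boundary_eq (mem_sdiff.2 ⟨htW', htA'⟩)
    (hnot hA').1 (by simp [htA]) hut.ne hut'.symm htt'.symm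
  have := card_sdiff_add_card_eq_card hA.subset
  omega

theorem exists_isMatchingOn_univ_of_adj (hG : IsCubic3EdgeConnected G) (h : G.Adj u v) :
    ∃ m, IsMatchingOn G univ m ∧ m u = v := by
  have hW : boundary G {u, v}ᶜ = 4 := by rw [boundary_compl, hG.boundary_pair h]
  have heven : Even #({u, v}ᶜ : Finset V) := by
    rw [← Nat.not_odd_iff_even, ← hG.odd_boundary_iff, hW]
    decide
  obtain ⟨n, hn⟩ := hG.exists_isMatchingOn heven hW.le ⟨u, by simp⟩
  exact ⟨_, hn.comp_swap h⟩

end IsCubic3EdgeConnected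

end Triangle

section AttachTriangle

variable {X : Type*}

/-- The graph obtained from `K` by adding a triangle and joining its vertices `i` to `p i`. -/
def attachTriangle (K : SimpleGraph X) (p : Fin 3 → X) : SimpleGraph (X ⊕ Fin 3) where
  Adj
    | .inl x, .inl y => K.Adj x y
    | .inl x, .inr i => p i = x
    | .inr i, .inl x => p i = x
    | .inr i, .inr j => i ≠ j
  symm := ⟨by
    rintro (x | i) (y | j) h
    exacts [K.adj_symm h, h, h, Ne.symm h]⟩
  loopless := ⟨by
    rintro (x | i) h
    exacts [K.irrefl h, h rfl]⟩

/-- The graph obtained from `K` by adding a vertex `none` joined to each `p i`. Replacing this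
vertex with a triangle gives `attachTriangle K p`. -/
def attachVertex (K : SimpleGraph X) (p : Fin 3 → X) : SimpleGraph (Option X) where
  Adj
    | some x, some y => K.Adj x y
    | some x, none => ∃ i, p i = x
    | none, some x => ∃ i, p i = x
    | none, none => False
  symm := ⟨by
    rintro (_ | x) (_ | y) h
    exacts [h, h, h, K.adj_symm h]⟩
  loopless := ⟨by
    rintro (_ | x) h
    exacts [h, K.irrefl h]⟩

variable {K : SimpleGraph X} {p : Fin 3 → X} {x y : X} {i j : Fin 3}

@[simp] theorem attachTriangle_inl_inl :
    (attachTriangle K p).Adj (.inl x) (.inl y) ↔ K.Adj x y := Iff.rfl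

@[simp] theorem attachTriangle_inl_inr :
    (attachTriangle K p).Adj (.inl x) (.inr i) ↔ p i = x := Iff.rfl

@[simp] theorem attachTriangle_inr_inl :
    (attachTriangle K p).Adj (.inr i) (.inl x) ↔ p i = x := Iff.rfl

@[simp] theorem attachTriangle_inr_inr :
    (attachTriangle K p).Adj (.inr i) (.inr j) ↔ i ≠ j := Iff.rfl

@[simp] theorem attachVertex_some_some :
    (attachVertex K p).Adj (some x) (some y) ↔ K.Adj x y := Iff.rfl

@[simp] theorem attachVertex_none_some :
    (attachVertex K p).Adj none (some x) ↔ ∃ i, p i = x := Iff.rfl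

/-- The contraction of the triangle of `attachTriangle K p`, onto the vertex set of
`attachVertex K p`. -/
def collapse : X ⊕ Fin 3 → Option X :=
  Sum.elim some fun _ => none

@[simp] theorem collapse_inl : collapse (.inl x) = some x := rfl

@[simp] theorem collapse_inr : collapse (.inr i : X ⊕ Fin 3) = none := rfl

theorem collapse_surjective : Function.Surjective (collapse (X := X))
  | none => ⟨.inr 0, rfl⟩
  | some x => ⟨.inl x, rfl⟩

theorem adj_collapse {z w : X ⊕ Fin 3} (h : (attachTriangle K p).Adj z w)
    (hne : collapse z ≠ collapse w) : (attachVertex K p).Adj (collapse z) (collapse w) := by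
  rcases z with x | i <;> rcases w with y | j
  exacts [h, ⟨_, h⟩, ⟨_, h⟩, absurd rfl hne]

theorem exists_adj_of_adj {a b : Option X} (h : (attachVertex K p).Adj a b) :
    ∃ z w, (attachTriangle K p).Adj z w ∧ collapse z = a ∧ collapse w = b := by
  rcases a with _ | x <;> rcases b with _ | y
  · exact h.elim
  · obtain ⟨i, hi⟩ := h
    exact ⟨.inr i, .inl y, hi, rfl, rfl⟩
  · obtain ⟨i, hi⟩ := h
    exact ⟨.inl x, .inr i, hi, rfl, rfl⟩
  · exact ⟨.inl x, .inl y, h, rfl, rfl⟩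

theorem eq_of_collapse_eq (hp : Function.Injective p) {z w z' w' : X ⊕ Fin 3}
    (h : (attachTriangle K p).Adj z w) (h' : (attachTriangle K p).Adj z' w')
    (hne : collapse z ≠ collapse w) (hz : collapse z = collapse z')
    (hw : collapse w = collapse w') : z = z' ∧ w = w' := by
  rcases z with x | i <;> rcases w with y | j <;> rcases z' with x' | i' <;>
    rcases w' with y' | j' <;> simp_all [← hp.eq_iff]

variable [Fintype X]

theorem edgeCount_none_univ (hp : Function.Injective p) :
    edgeCount (attachVertex K p) {none} univ = 3 := by
  classical
  have hnbrs : ({z | (attachVertex K p).Adj none z} : Finset (Option X)) =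
      univ.map ⟨fun i => some (p i), (Option.some_injective X).comp hp⟩ := by
    ext (_ | y) <;> simp
  rw [edgeCount_singleton, hnbrs, card_map, card_fin]

variable [DecidableEq X]

theorem edgeCount_filter_collapse (hp : Function.Injective p) {Y Z : Finset (Option X)}
    (h : Disjoint Y Z) :
    edgeCount (attachTriangle K p) {z | collapse z ∈ Y} {z | collapse z ∈ Z} =
      edgeCount (attachVertex K p) Y Z := by
  classical
  have hne {a b} (ha : a ∈ Y) (hb : b ∈ Z) : a ≠ b := fun hab => disjoint_left.1 h ha (hab ▸ hb)
  refine card_nbij (fun q => (collapse q.1, collapse q.2)) ?_ ?_ ?_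
  · rintro ⟨z, w⟩ hq
    simp only [coe_filter, SimpleGraph.interedges_def, mem_product, mem_filter, mem_univ,
      true_and, Set.mem_ofPred_eq] at hq ⊢
    exact ⟨hq.1, adj_collapse hq.2 (hne hq.1.1 hq.1.2)⟩
  · rintro ⟨z, w⟩ hq ⟨z', w'⟩ hq' heq
    simp only [SimpleGraph.interedges_def, mem_coe, mem_product, mem_filter, mem_univ,
      true_and] at hq hq'
    rw [Prod.mk.injEq] at heq ⊢
    exact eq_of_collapse_eq hp hq.2 hq'.2 (hne hq.1.1 hq.1.2) heq.1 heq.2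
  · rintro ⟨a, b⟩ hq
    obtain ⟨ha, hb, hab⟩ := (attachVertex K p).mk_mem_interedges_iff.1 (mem_coe.1 hq)
    obtain ⟨z, w, hzw, rfl, rfl⟩ := exists_adj_of_adj hab
    exact ⟨(z, w), by simp [SimpleGraph.mk_mem_interedges_iff, ha, hb, hzw], rfl⟩

theorem boundary_filter_collapse (hp : Function.Injective p) (Y : Finset (Option X)) :
    boundary (attachTriangle K p) {z | collapse z ∈ Y} = boundary (attachVertex K p) Y := by
  rw [boundary, boundary, ← edgeCount_filter_collapse hp disjoint_compl_right]
  simp only [mem_compl, compl_filter]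

theorem IsCubic3EdgeConnected.attachVertex (hG : IsCubic3EdgeConnected (attachTriangle K p))
    (hp : Function.Injective p) : IsCubic3EdgeConnected (attachVertex K p) := by
  refine ⟨?_, fun Y hY hYc => ?_⟩
  · rintro (_ | x)
    · exact edgeCount_none_univ hp
    · have hfiber :
          ({z | collapse z ∈ ({some x} : Finset (Option X))} : Finset (X ⊕ Fin 3)) = {.inl x} := by
        ext (y | i) <;> simp
      rw [← LonelyEdge.boundary_singleton, ← boundary_filter_collapse hp, hfiber,
        hG.boundary_singleton]
  · obtain ⟨a, ha⟩ := hY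
    obtain ⟨b, hb⟩ := hYc
    obtain ⟨z, rfl⟩ := collapse_surjective a
    obtain ⟨w, rfl⟩ := collapse_surjective b
    rw [← boundary_filter_collapse hp]
    exact hG.three_le_boundary _ ⟨z, by simpa using ha⟩ ⟨w, by simpa using hb⟩

end AttachTriangle

section LonelyGraph

variable {V : Type*} [Fintype V] {G : SimpleGraph V} {u v : V}

/-- The spanning subgraph of `G` formed by the edges that lie in exactly one perfect matching. -/
def lonelyGraph (G : SimpleGraph V) : SimpleGraph V where
  Adj := IsLonelyEdge G
  symm := ⟨fun u v h => by
    refine ⟨h.1.symm, (existsUnique_congr fun m => and_congr_right fun hm => ?_).1 h.2⟩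
    rw [hm.involutive.eq_iff, eq_comm]⟩
  loopless := ⟨fun _ h => G.irrefl h.1⟩

@[simp] theorem lonelyGraph_adj : (lonelyGraph G).Adj u v ↔ IsLonelyEdge G u v := Iff.rfl

/-- The number of lonely edges of a simple graph. -/
noncomputable def lonelyNumber (G : SimpleGraph V) : ℕ :=
  (lonelyGraph G).edgeSet.ncard

end LonelyGraph

section LiftMatching

variable {X : Type*} {K : SimpleGraph X} {p : Fin 3 → X} {f g n : Option X → Option X}
  {i j k : Fin 3} {x y : X}

/-- The perfect matching of `attachTriangle K p` obtained from a perfect matching `f` of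
`attachVertex K p` with `f none = some (p i)`. As indices are taken modulo `3`, the vertex of the
triangle other than `i` and `j` is `-(i + j)`. -/
def liftMatching (p : Fin 3 → X) (f : Option X → Option X) (i : Fin 3) : X ⊕ Fin 3 → X ⊕ Fin 3 :=
  Sum.elim (fun x => (f (some x)).elim (.inr i) .inl)
    fun j => if j = i then .inl (p i) else .inr (-(i + j))

theorem liftMatching_inl_of_eq_none (h : f (some x) = none) :
    liftMatching p f i (.inl x) = .inr i := by
  simp [liftMatching, h]

theorem liftMatching_inl_of_eq_some (h : f (some x) = some y) :
    liftMatching p f i (.inl x) = .inl y := by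
  simp [liftMatching, h]

theorem liftMatching_inr_self : liftMatching p f i (.inr i) = .inl (p i) := by
  simp [liftMatching]

theorem liftMatching_inr_of_ne (h : j ≠ i) : liftMatching p f i (.inr j) = .inr (-(i + j)) := by
  simp [liftMatching, h]

theorem eq_of_liftMatching_eq (hf : f none = some (p i)) (hg : g none = some (p j))
    (h : liftMatching p f i = liftMatching p g j) : f = g := by
  obtain rfl : i = j := by
    by_contra hij
    have hi := congrFun h (.inr i)
    rw [liftMatching_inr_self, liftMatching_inr_of_ne hij] at hi
    exact Sum.inl_ne_inr hi
  funext z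
  rcases z with _ | x
  · rw [hf, hg]
  · have hx := congrFun h (.inl x)
    cases hfx : f (some x) <;> cases hgx : g (some x) <;> simp_all [liftMatching]

/-- The perfect matching of `attachTriangle K p` consisting of the three edges that leave the
triangle and of a perfect matching `n` of the rest. -/
noncomputable def spokeMatching (p : Fin 3 → X) (n : Option X → Option X) :
    X ⊕ Fin 3 → X ⊕ Fin 3 :=
  Sum.elim (Function.extend p .inr fun x => (n (some x)).elim (.inr 0) .inl) (Sum.inl ∘ p)

theorem spokeMatching_inl_apply (hp : Function.Injective p) :
    spokeMatching p n (.inl (p i)) = .inr i := by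
  simp [spokeMatching, hp.extend_apply]

theorem spokeMatching_inl (hx : x ∉ Set.range p) (h : n (some x) = some y) :
    spokeMatching p n (.inl x) = .inl y := by
  simp [spokeMatching, Function.extend_apply' _ _ _ hx, h]

variable {W : Finset (Option X)}

theorem IsMatchingOn.exists_apply_some (hn : IsMatchingOn (attachVertex K p) W n)
    (hW : ∀ z, z ∈ W ↔ z ≠ none ∧ ¬ (attachVertex K p).Adj none z) (hx : x ∉ Set.range p) :
    ∃ y ∉ Set.range p, n (some x) = some y ∧ n (some y) = some x ∧ K.Adj x y := by
  have hxW : some x ∈ W := (hW _).2 ⟨Option.some_ne_none x, hx⟩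
  obtain ⟨hne, hnadj⟩ := (hW _).1 (hn.apply_mem hxW)
  obtain ⟨y, hy⟩ := Option.ne_none_iff_exists'.1 hne
  have hadj := hn.adj _ hxW
  rw [hy] at hnadj hadj
  exact ⟨y, hnadj, hy, by rw [← hy, hn.involutive], hadj⟩

/-- Sends the edges of `K` to themselves, and an edge of the triangle to the edge joining the new
vertex of `attachVertex K p` to the neighbour of the third vertex of the triangle. The other edges
of `attachTriangle K p` get the junk value `s(none, none)`. -/
def oppositeEdge (p : Fin 3 → X) : Sym2 (X ⊕ Fin 3) → Sym2 (Option X) :=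
  Sym2.lift ⟨fun
    | .inl x, .inl y => s(some x, some y)
    | .inr j, .inr k => s(none, some (p (-(j + k))))
    | _, _ => s(none, none), by
      rintro (x | j) (y | k)
      exacts [Sym2.eq_swap, rfl, rfl, by simp only [add_comm j k]]⟩

theorem oppositeEdge_inl_inl : oppositeEdge p s(.inl x, .inl y) = s(some x, some y) := rfl

theorem oppositeEdge_inr_inr :
    oppositeEdge p s(.inr j, .inr k) = s(none, some (p (-(j + k)))) := rfl

variable [Fintype X]

theorem IsMatchingOn.liftMatching (hf : IsMatchingOn (attachVertex K p) univ f)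
    (hi : f none = some (p i)) : IsMatchingOn (attachTriangle K p) univ (liftMatching p f i) := by
  have hpi : f (some (p i)) = none := by rw [← hi, hf.involutive]
  have hthird : ∀ i j : Fin 3, j ≠ i → -(i + j) ≠ i ∧ -(i + -(i + j)) = j ∧ j ≠ -(i + j) := by
    decide
  refine ⟨?_, ?_, fun z hz => absurd (mem_univ z) hz⟩
  · rintro (x | j)
    · cases hx : f (some x) with
      | none =>
        have hxi : x = p i := by
          rw [← Option.some_inj, ← hi, ← hx, hf.involutive]
        rw [liftMatching_inl_of_eq_none hx, liftMatching_inr_self, hxi]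
      | some y =>
        rw [liftMatching_inl_of_eq_some hx, liftMatching_inl_of_eq_some]
        rw [← hx, hf.involutive]
    · obtain rfl | hj := eq_or_ne j i
      · rw [liftMatching_inr_self, liftMatching_inl_of_eq_none hpi]
      · rw [liftMatching_inr_of_ne hj, liftMatching_inr_of_ne (hthird i j hj).1,
          (hthird i j hj).2.1]
  · rintro (x | j) -
    · have hadj := hf.adj (some x) (mem_univ _)
      cases hx : f (some x) with
      | none =>
        rw [liftMatching_inl_of_eq_none hx, attachTriangle_inl_inr, ← Option.some_inj, ← hi, ← hx,
          hf.involutive]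
      | some y =>
        rw [hx] at hadj
        rwa [liftMatching_inl_of_eq_some hx]
    · obtain rfl | hj := eq_or_ne j i
      · rw [liftMatching_inr_self, attachTriangle_inr_inl]
      · rw [liftMatching_inr_of_ne hj]
        exact (hthird i j hj).2.2

theorem IsMatchingOn.exists_apply_none (hf : IsMatchingOn (attachVertex K p) univ f) :
    ∃ i, f none = some (p i) := by
  have hadj := hf.adj none (mem_univ _)
  cases hnone : f none with
  | none =>
    rw [hnone] at hadj
    exact hadj.elim
  | some x =>
    rw [hnone] at hadj
    obtain ⟨i, rfl⟩ := hadj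
    exact ⟨i, rfl⟩

theorem IsLonelyEdge.of_liftMatching [DecidableEq X]
    (hG : IsCubic3EdgeConnected (attachVertex K p)) {z w : X ⊕ Fin 3} {a b : Option X}
    (h : IsLonelyEdge (attachTriangle K p) z w) (hab : (attachVertex K p).Adj a b)
    (hlift : ∀ f i, IsMatchingOn (attachVertex K p) univ f → f none = some (p i) → f a = b →
      liftMatching p f i z = w) : IsLonelyEdge (attachVertex K p) a b := by
  obtain ⟨f, hf, hfab⟩ := hG.exists_isMatchingOn_univ_of_adj hab
  refine ⟨hab, f, ⟨hf, hfab⟩, fun g ⟨hg, hgab⟩ => ?_⟩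
  obtain ⟨i, hi⟩ := hf.exists_apply_none
  obtain ⟨j, hj⟩ := hg.exists_apply_none
  exact eq_of_liftMatching_eq hj hi (h.2.unique ⟨hg.liftMatching hj, hlift g j hg hj hgab⟩
    ⟨hf.liftMatching hi, hlift f i hf hi hfab⟩)

theorem card_sum_fin_three (hp : Function.Injective p) : 4 < Fintype.card (X ⊕ Fin 3) := by
  have := Fintype.card_le_of_injective p hp
  rw [Fintype.card_fin] at this
  rw [Fintype.card_sum, Fintype.card_fin]
  omega

theorem IsMatchingOn.spokeMatching (hn : IsMatchingOn (attachVertex K p) W n)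
    (hp : Function.Injective p)
    (hW : ∀ z, z ∈ W ↔ z ≠ none ∧ ¬ (attachVertex K p).Adj none z) :
    IsMatchingOn (attachTriangle K p) univ (spokeMatching p n) := by
  refine ⟨?_, ?_, fun z hz => absurd (mem_univ z) hz⟩
  · rintro (x | i)
    · by_cases hx : x ∈ Set.range p
      · obtain ⟨i, rfl⟩ := hx
        rw [spokeMatching_inl_apply hp]
        rfl
      · obtain ⟨y, hy, hxy, hyx, -⟩ := hn.exists_apply_some hW hx
        rw [spokeMatching_inl hx hxy, spokeMatching_inl hy hyx]
    · exact spokeMatching_inl_apply hp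
  · rintro (x | i) -
    · by_cases hx : x ∈ Set.range p
      · obtain ⟨i, rfl⟩ := hx
        rw [spokeMatching_inl_apply hp, attachTriangle_inl_inr]
      · obtain ⟨y, -, hxy, -, hadj⟩ := hn.exists_apply_some hW hx
        rwa [spokeMatching_inl hx hxy]
    · exact attachTriangle_inr_inl.2 rfl

variable [DecidableEq X]

theorem not_isLonelyEdge_inr_inl (hG : IsCubic3EdgeConnected (attachTriangle K p))
    (hp : Function.Injective p) : ¬ IsLonelyEdge (attachTriangle K p) (.inr i) (.inl x) := by
  refine hG.not_isLonelyEdge_of_triangle (card_sum_fin_three hp) (t := .inr (i + 1))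
    (t' := .inr (i + 2)) ?_ ?_ ?_ Sum.inl_ne_inr Sum.inl_ne_inr <;>
  · rw [attachTriangle_inr_inr]
    revert i
    decide

theorem exists_eq_of_mem_lonelyGraph (hG : IsCubic3EdgeConnected (attachTriangle K p))
    (hp : Function.Injective p) {e : Sym2 (X ⊕ Fin 3)}
    (he : e ∈ (lonelyGraph (attachTriangle K p)).edgeSet) :
    (∃ x y, e = s(.inl x, .inl y)) ∨ ∃ j k, j ≠ k ∧ e = s(.inr j, .inr k) := by
  induction e with | _ z w
  have hlonely : IsLonelyEdge (attachTriangle K p) z w := he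
  rcases z with x | j <;> rcases w with y | k
  · exact .inl ⟨x, y, rfl⟩
  · exact (not_isLonelyEdge_inr_inl hG hp ((lonelyGraph _).adj_symm hlonely)).elim
  · exact (not_isLonelyEdge_inr_inl hG hp hlonely).elim
  · exact .inr ⟨j, k, hlonely.1, rfl⟩

theorem oppositeEdge_mem_lonelyGraph (hG : IsCubic3EdgeConnected (attachTriangle K p))
    (hp : Function.Injective p) {e : Sym2 (X ⊕ Fin 3)}
    (he : e ∈ (lonelyGraph (attachTriangle K p)).edgeSet) :
    oppositeEdge p e ∈ (lonelyGraph (attachVertex K p)).edgeSet := by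
  obtain ⟨x, y, rfl⟩ | ⟨j, k, hjk, rfl⟩ := exists_eq_of_mem_lonelyGraph hG hp he
  · have hlonely : IsLonelyEdge (attachTriangle K p) (.inl x) (.inl y) := he
    exact hlonely.of_liftMatching (hG.attachVertex hp) hlonely.1
      fun f i _ _ hxy => liftMatching_inl_of_eq_some hxy
  · have hlonely : IsLonelyEdge (attachTriangle K p) (.inr j) (.inr k) := he
    refine hlonely.of_liftMatching (hG.attachVertex hp) ⟨_, rfl⟩ fun f i _ hi hf => ?_
    obtain rfl : i = -(j + k) := hp (Option.some_injective X (hi.symm.trans hf))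
    have hthird : ∀ j k : Fin 3, j ≠ k → j ≠ -(j + k) ∧ -(-(j + k) + j) = k := by decide
    rw [liftMatching_inr_of_ne (hthird j k hjk).1, (hthird j k hjk).2]

theorem injOn_oppositeEdge (hG : IsCubic3EdgeConnected (attachTriangle K p))
    (hp : Function.Injective p) :
    Set.InjOn (oppositeEdge p) (lonelyGraph (attachTriangle K p)).edgeSet := by
  have hpair : ∀ j k j' k' : Fin 3, j ≠ k → j' ≠ k' → -(j + k) = -(j' + k') →
      s(j, k) = s(j', k') := by decide
  intro e he e' he' heq
  obtain ⟨x, y, rfl⟩ | ⟨j, k, hjk, rfl⟩ := exists_eq_of_mem_lonelyGraph hG hp he <;>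
    obtain ⟨x', y', rfl⟩ | ⟨j', k', hjk', rfl⟩ := exists_eq_of_mem_lonelyGraph hG hp he'
  · simpa [oppositeEdge_inl_inl] using heq
  · simp [oppositeEdge_inl_inl, oppositeEdge_inr_inr] at heq
  · simp [oppositeEdge_inl_inl, oppositeEdge_inr_inr] at heq
  · have hthird : -(j + k) = -(j' + k') := by
      simpa [oppositeEdge_inr_inr, hp.eq_iff] using heq
    exact congrArg (Sym2.map Sum.inr) (hpair j k j' k' hjk hjk' hthird)

theorem lonelyNumber_attachTriangle_le (hG : IsCubic3EdgeConnected (attachTriangle K p))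
    (hp : Function.Injective p) :
    lonelyNumber (attachTriangle K p) ≤ lonelyNumber (attachVertex K p) :=
  Set.ncard_le_ncard_of_injOn _ (fun _ => oppositeEdge_mem_lonelyGraph hG hp)
    (injOn_oppositeEdge hG hp) (Set.toFinite _)

theorem not_isLonelyEdge_of_isMatchingOn (hn : IsMatchingOn (attachVertex K p) W n)
    (hp : Function.Injective p)
    (hW : ∀ z, z ∈ W ↔ z ≠ none ∧ ¬ (attachVertex K p).Adj none z)
    (hG : IsCubic3EdgeConnected (attachVertex K p)) (hx : x ∉ Set.range p)
    (hxy : n (some x) = some y) (hadj : K.Adj x y) :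
    ¬ IsLonelyEdge (attachTriangle K p) (.inl x) (.inl y) := by
  intro h
  obtain ⟨f, hf, hfxy⟩ := hG.exists_isMatchingOn_univ_of_adj (attachVertex_some_some.2 hadj)
  obtain ⟨i, hi⟩ := hf.exists_apply_none
  have heq := h.2.unique ⟨hn.spokeMatching hp hW, spokeMatching_inl hx hxy⟩
    ⟨hf.liftMatching hi, liftMatching_inl_of_eq_some hfxy⟩
  have hnext : ∀ i : Fin 3, i + 1 ≠ i := by decide
  have hspoke := congrFun heq (.inr (i + 1))
  rw [liftMatching_inr_of_ne (hnext i)] at hspoke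
  exact Sum.inl_ne_inr hspoke

theorem lonelyNumber_attachTriangle_lt (hG : IsCubic3EdgeConnected (attachTriangle K p))
    (hp : Function.Injective p) (hn : IsMatchingOn (attachVertex K p) W n)
    (hW : ∀ z, z ∈ W ↔ z ≠ none ∧ ¬ (attachVertex K p).Adj none z) {z : Option X} (hz : z ∈ W)
    (hlonely : IsLonelyEdge (attachVertex K p) z (n z)) :
    lonelyNumber (attachTriangle K p) < lonelyNumber (attachVertex K p) := by
  obtain ⟨hne, hnadj⟩ := (hW z).1 hz
  obtain ⟨x, rfl⟩ := Option.ne_none_iff_exists'.1 hne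
  obtain ⟨y, hy, hxy, hyx, hadj⟩ := hn.exists_apply_some hW hnadj
  have hmiss : ∀ e ∈ (lonelyGraph (attachTriangle K p)).edgeSet,
      oppositeEdge p e ≠ s(some x, some y) := by
    intro e he heq
    obtain ⟨x', y', rfl⟩ | ⟨j, k, -, rfl⟩ := exists_eq_of_mem_lonelyGraph hG hp he
    · rw [oppositeEdge_inl_inl, Sym2.eq_iff] at heq
      simp only [Option.some_inj] at heq
      have hlost {x' y'} := not_isLonelyEdge_of_isMatchingOn (x := x') (y := y') hn hp hW
        (hG.attachVertex hp)
      obtain ⟨rfl, rfl⟩ | ⟨rfl, rfl⟩ := heq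
      · exact hlost hnadj hxy hadj he
      · exact hlost hy hyx hadj.symm he
    · simp [oppositeEdge_inr_inr] at heq
  rw [hxy] at hlonely
  have hmem : s(some x, some y) ∈ (lonelyGraph (attachVertex K p)).edgeSet := hlonely
  refine (Set.ncard_le_ncard_of_injOn _ (fun e he => ?_) (injOn_oppositeEdge hG hp)
    (Set.toFinite _)).trans_lt (Set.ncard_sdiff_singleton_lt_of_mem hmem)
  exact ⟨oppositeEdge_mem_lonelyGraph hG hp he, hmiss e he⟩

end LiftMatching

section Iso

variable {V V' : Type*} {G : SimpleGraph V} {G' : SimpleGraph V'} {W : Finset V} {m : V → V}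
  {u v : V}

theorem edgeCount_map (e : G ≃g G') (X Y : Finset V) :
    edgeCount G' (X.map e.toEquiv.toEmbedding) (Y.map e.toEquiv.toEmbedding) =
      edgeCount G X Y := by
  classical
  refine (card_equiv (e.toEquiv.prodCongr e.toEquiv) fun ⟨x, y⟩ => ?_).symm
  rw [SimpleGraph.mk_mem_interedges_iff]
  exact (G'.mk_mem_interedges_iff.trans <| and_congr (mem_map' _) <|
    and_congr (mem_map' _) e.map_adj_iff).symm

theorem IsMatchingOn.map (hm : IsMatchingOn G W m) (e : G ≃g G') :
    IsMatchingOn G' (W.map e.toEquiv.toEmbedding) fun v => e (m (e.symm v)) := by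
  refine ⟨fun v => by simp [hm.involutive _], fun v hv => ?_, fun v hv => ?_⟩
  · rw [← e.symm.map_adj_iff, e.symm_apply_apply]
    exact hm.adj _ (mem_map_equiv.1 hv)
  · have hfix := hm.apply_of_notMem (e.symm v) fun h => hv (mem_map_equiv.2 h)
    rw [hfix, e.apply_symm_apply]

variable [Fintype V] [Fintype V']

theorem IsLonelyEdge.map (h : IsLonelyEdge G u v) (e : G ≃g G') :
    IsLonelyEdge G' (e u) (e v) := by
  obtain ⟨hadj, m, ⟨hm, rfl⟩, huniq⟩ := h
  have hmap := hm.map e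
  rw [map_univ_equiv] at hmap
  refine ⟨e.map_adj_iff.2 hadj, _, ⟨hmap, by simp⟩, fun n ⟨hn, hnu⟩ => ?_⟩
  have hback := hn.map e.symm
  rw [map_univ_equiv] at hback
  funext x
  simp [← huniq _ ⟨hback, by simp [hnu]⟩]

theorem isLonelyEdge_map_iff (e : G ≃g G') :
    IsLonelyEdge G' (e u) (e v) ↔ IsLonelyEdge G u v :=
  ⟨fun h => by simpa using h.map e.symm, fun h => h.map e⟩

theorem lonelyNumber_eq_of_iso (e : G ≃g G') : lonelyNumber G = lonelyNumber G' :=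
  let lonelyIso : lonelyGraph G ≃g lonelyGraph G' := ⟨e.toEquiv, isLonelyEdge_map_iff e⟩
  Nat.card_congr lonelyIso.mapEdgeSet

theorem IsCubic3EdgeConnected.of_iso [DecidableEq V] [DecidableEq V']
    (hG' : IsCubic3EdgeConnected G') (e : G ≃g G') : IsCubic3EdgeConnected G := by
  refine ⟨fun v => ?_, fun X hX hXc => ?_⟩
  · rw [← edgeCount_map e, map_univ_equiv, map_singleton]
    exact hG'.edgeCount_singleton_univ _
  · have hcompl : (X.map e.toEquiv.toEmbedding)ᶜ = Xᶜ.map e.toEquiv.toEmbedding := by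
      ext v
      simp [mem_map_equiv]
    rw [boundary, ← edgeCount_map e, ← hcompl]
    exact hG'.three_le_boundary _ hX.map (hcompl ▸ hXc.map)

end Iso

section TriangleReplacement

variable {X X' : Type*} {K : SimpleGraph X} {K' : SimpleGraph X'} {p : Fin 3 → X}
  {p' : Fin 3 → X'}

theorem nonempty_attachTriangle_iso (hp : Function.Injective p)
    (φ : attachVertex K p ≃g attachVertex K' p') (hφ : φ none = none) :
    Nonempty (attachTriangle K p ≃g attachTriangle K' p') := by
  let ψ : X ≃ X' := φ.toEquiv.removeNone
  have hψ (x) : φ (some x) = some (ψ x) := by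
    refine (Equiv.removeNone_some φ.toEquiv (Option.ne_none_iff_exists'.1 fun h => ?_)).symm
    exact Option.some_ne_none x (φ.injective (h.trans hφ.symm))
  have hspoke (i) : ∃ j, p' j = ψ (p i) := by
    rw [← attachVertex_none_some (K := K'), ← hφ, ← hψ, φ.map_adj_iff]
    exact ⟨i, rfl⟩
  choose σ hσ using hspoke
  have hσinj : Function.Injective σ := fun i j hij => hp <| ψ.injective <| by
    rw [← hσ, ← hσ, hij]
  let τ : Fin 3 ≃ Fin 3 := .ofBijective σ (Finite.injective_iff_bijective.1 hσinj)
  have hτ (i x) : p' (τ i) = ψ x ↔ p i = x := by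
    rw [← ψ.injective.eq_iff, ← hσ]
    rfl
  refine ⟨⟨ψ.sumCongr τ, ?_⟩⟩
  rintro (x | i) (y | j)
  · simp [← attachVertex_some_some (p := p), ← φ.map_adj_iff, hψ]
  · exact hτ j x
  · exact hτ i y
  · simp

variable {V : Type*} [Fintype V] [DecidableEq V] {G : SimpleGraph V} {T : Finset V} {x : V}

namespace IsCubic3EdgeConnected

theorem edgeCount_compl_of_isNClique (hG : IsCubic3EdgeConnected G) (hT : G.IsNClique 3 T)
    (hx : x ∈ T) : edgeCount G {x} Tᶜ = 1 := by
  classical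
  have hinside : edgeCount G {x} T = 2 := by
    have hfilter : {y ∈ T | G.Adj x y} = T.erase x := by
      ext y
      rw [mem_filter, mem_erase, and_comm]
      exact and_congr_left fun hy => ⟨fun h => h.ne', fun h => hT.1 hx hy h.symm⟩
    rw [edgeCount_singleton, hfilter, card_erase_of_mem hx, hT.2]
  have := edgeCount_add_edgeCount_compl (G := G) {x} T
  rw [hG.edgeCount_singleton_univ, hinside] at this
  omega

theorem boundary_of_isNClique (hG : IsCubic3EdgeConnected G) (hT : G.IsNClique 3 T) :
    boundary G T = 3 := by
  rw [boundary, edgeCount_eq_sum, sum_congr rfl fun x => hG.edgeCount_compl_of_isNClique hT,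
    sum_const, hT.2, smul_eq_mul]

theorem exists_forall_adj_iff (hG : IsCubic3EdgeConnected G) (hT : G.IsNClique 3 T)
    (hx : x ∈ T) : ∃ w : {v // v ∉ T}, ∀ v ∉ T, G.Adj x v ↔ w = v := by
  classical
  have hone := hG.edgeCount_compl_of_isNClique hT hx
  rw [edgeCount_singleton, card_eq_one] at hone
  obtain ⟨w, hw⟩ := hone
  have hiff (v) : v ∉ T ∧ G.Adj x v ↔ v = w := by
    rw [← mem_compl, ← mem_filter, hw, mem_singleton]
  exact ⟨⟨w, ((hiff w).2 rfl).1⟩, fun v hv => by rw [eq_comm, ← hiff, and_iff_right hv]⟩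

theorem exists_iso_attachTriangle.{u} {V : Type u} [Fintype V] [DecidableEq V]
    {G : SimpleGraph V} {T : Finset V} (hG : IsCubic3EdgeConnected G) (hT : G.IsNClique 3 T)
    (hV : 4 < Fintype.card V) :
    ∃ (X : Type u) (_ : Fintype X) (_ : DecidableEq X) (K : SimpleGraph X) (p : Fin 3 → X),
      Function.Injective p ∧ Nonempty (attachTriangle K p ≃g G) := by
  let t := (T.equivFinOfCardEq hT.2).symm
  choose p hp using fun i => hG.exists_forall_adj_iff hT (t i).2
  refine ⟨{v // v ∉ T}, inferInstance, inferInstance, G.comap Subtype.val, p, ?_, ?_⟩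
  · intro i j hij
    by_contra hne
    have hadj (k) (hk : p i = p k) : G.Adj (p i) (t k) := ((hp k _ (p i).2).2 (by rw [hk])).symm
    have htwo := two_le_edgeCount (t i).2 (t j).2 (fun h => hne (t.injective (Subtype.ext h)))
      (hadj i rfl) (hadj j hij)
    obtain ⟨y, hy⟩ : ∃ y, y ∉ insert (p i : V) T := by
      by_contra! hall
      have := card_le_card (fun v _ => hall v : univ ⊆ insert (p i : V) T)
      rw [card_insert_of_notMem (p i).2, hT.2, card_univ] at this
      omega
    rw [mem_insert, not_or] at hy
    have hle := hG.edgeCount_singleton_le_one (hG.boundary_of_isNClique hT) (p i).2 hy.2 hy.1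
    omega
  · refine ⟨⟨((Equiv.refl _).sumCongr t).trans <|
      (Equiv.sumComm _ _).trans (Equiv.sumCompl (· ∈ T)), ?_⟩⟩
    rintro (x | i) (y | j)
    · exact Iff.rfl
    · simpa [G.adj_comm, Subtype.ext_iff] using hp j x x.2
    · simpa [Subtype.ext_iff] using hp i y y.2
    · have hadj : G.Adj (t i) (t j) ↔ i ≠ j :=
        ⟨fun h hij => h.ne (by rw [hij]),
          fun h => hT.1 (t i).2 (t j).2 fun h' => h (t.injective (Subtype.ext h'))⟩
      simpa using hadj

end IsCubic3EdgeConnected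

end TriangleReplacement

section PerfectMatchingLists

variable {V : Type*} [Fintype V] {G : SimpleGraph V} {L : Finset (V → V)} {m : V → V} {u v : V}

theorem isMatchingOn_univ_iff : IsMatchingOn G univ m ↔ ∀ v, m (m v) = v ∧ G.Adj v (m v) :=
  ⟨fun h v => ⟨h.involutive v, h.adj v (mem_univ v)⟩,
    fun h => ⟨fun v => (h v).1, fun v _ => (h v).2, fun v hv => absurd (mem_univ v) hv⟩⟩

theorem isMatchingOn_univ_iff_mem {ι : Type*} {N : V → ι → V}
    (hN : ∀ u v, G.Adj u v ↔ ∃ i, N u i = v)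
    (hsound : ∀ m ∈ L, ∀ v, m (m v) = v ∧ G.Adj v (m v))
    (hcomplete : ∀ c : V → ι, (∀ v, N (N v (c v)) (c (N v (c v))) = v) →
      (fun v => N v (c v)) ∈ L) :
    IsMatchingOn G univ m ↔ m ∈ L := by
  refine ⟨fun h => ?_, fun h => isMatchingOn_univ_iff.2 (hsound m h)⟩
  choose c hc using fun v => (hN v (m v)).1 (h.adj v (mem_univ v))
  have hm : (fun v => N v (c v)) = m := funext hc
  rw [← hm]
  refine hcomplete c fun v => ?_
  rw [hc, hc, h.involutive]

variable [DecidableEq V]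

theorem isLonelyEdge_iff_card_eq_one (hL : ∀ m, IsMatchingOn G univ m ↔ m ∈ L) :
    IsLonelyEdge G u v ↔ G.Adj u v ∧ #{m ∈ L | m u = v} = 1 := by
  simp only [IsLonelyEdge, hL, card_eq_one_iff_existsUnique, mem_filter]

theorem two_mul_lonelyNumber [DecidableRel G.Adj] (hL : ∀ m, IsMatchingOn G univ m ↔ m ∈ L) :
    2 * lonelyNumber G = #{q : V × V | G.Adj q.1 q.2 ∧ #{m ∈ L | m q.1 = q.2} = 1} := by
  classical
  rw [lonelyNumber, ← SimpleGraph.coe_edgeFinset, Set.ncard_coe_finset,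
    SimpleGraph.two_mul_card_edgeFinset]
  simp only [lonelyGraph_adj, isLonelyEdge_iff_card_eq_one hL]

end PerfectMatchingLists

section ConcreteGraphs

theorem lonelyNumber_completeGraph : lonelyNumber (⊤ : SimpleGraph (Fin 4)) = 6 := by
  have hlist (m : Fin 4 → Fin 4) : IsMatchingOn ⊤ univ m ↔
      m ∈ ({![1, 0, 3, 2], ![2, 3, 0, 1], ![3, 2, 1, 0]} : Finset (Fin 4 → Fin 4)) := by
    rw [isMatchingOn_univ_iff]
    decide +kernel +revert
  have hcount := two_mul_lonelyNumber hlist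
  have hcard : #{q : Fin 4 × Fin 4 | (⊤ : SimpleGraph (Fin 4)).Adj q.1 q.2 ∧
      #{m ∈ ({![1, 0, 3, 2], ![2, 3, 0, 1], ![3, 2, 1, 0]} : Finset (Fin 4 → Fin 4)) |
        m q.1 = q.2} = 1} = 12 := by
    decide +kernel
  omega

/-- The prism as a simple graph. -/
def prismGraph : SimpleGraph (Fin 6) :=
  SimpleGraph.fromEdgeSet
    {s(0, 1), s(1, 2), s(0, 2), s(3, 4), s(4, 5), s(3, 5), s(0, 3), s(1, 4), s(2, 5)}

/-- The bicorn as a simple graph. -/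
def bicornGraph : SimpleGraph (Fin 8) :=
  SimpleGraph.fromEdgeSet
    {s(0, 1), s(1, 2), s(0, 2), s(0, 4), s(1, 6), s(2, 3),
     s(3, 4), s(4, 5), s(3, 7), s(5, 6), s(5, 7), s(6, 7)}

instance : DecidableRel prismGraph.Adj := by
  unfold prismGraph
  infer_instance

instance : DecidableRel bicornGraph.Adj := by
  unfold bicornGraph
  infer_instance

/-- The perfect matchings of the prism, as involutions. -/
def prismMatchings : Finset (Fin 6 → Fin 6) :=
  {![1, 0, 5, 4, 3, 2], ![2, 4, 0, 5, 1, 3], ![3, 2, 1, 0, 5, 4], ![3, 4, 5, 0, 1, 2]}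

/-- The perfect matchings of the bicorn, as involutions. -/
def bicornMatchings : Finset (Fin 8 → Fin 8) :=
  {![1, 0, 3, 2, 5, 4, 7, 6], ![2, 6, 0, 4, 3, 7, 1, 5], ![2, 6, 0, 7, 5, 4, 1, 3],
    ![4, 2, 1, 7, 0, 6, 5, 3], ![4, 6, 3, 2, 0, 7, 1, 5]}

/-- The three neighbours of each vertex of the prism: with them a perfect matching is one of
`3 ^ 6` choices of neighbours, few enough to be searched by evaluation. -/
def prismNeighbor : Fin 6 → Fin 3 → Fin 6 :=
  ![![1, 2, 3], ![0, 2, 4], ![0, 1, 5], ![0, 4, 5], ![1, 3, 5], ![2, 3, 4]]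

/-- The three neighbours of each vertex of the bicorn, to search for its perfect matchings as for
those of the prism. -/
def bicornNeighbor : Fin 8 → Fin 3 → Fin 8 :=
  ![![1, 2, 4], ![0, 2, 6], ![0, 1, 3], ![2, 4, 7], ![0, 3, 5], ![4, 6, 7], ![1, 5, 7], ![3, 5, 6]]

set_option maxRecDepth 100000 in
theorem isMatchingOn_prismGraph_iff (m : Fin 6 → Fin 6) :
    IsMatchingOn prismGraph univ m ↔ m ∈ prismMatchings := by
  refine isMatchingOn_univ_iff_mem (N := prismNeighbor) (by decide +kernel) ?_ (by decide +kernel)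
  simp only [prismMatchings, mem_insert, mem_singleton, forall_eq_or_imp, forall_eq]
  decide +kernel

set_option maxRecDepth 100000 in
theorem isMatchingOn_bicornGraph_iff (m : Fin 8 → Fin 8) :
    IsMatchingOn bicornGraph univ m ↔ m ∈ bicornMatchings := by
  refine isMatchingOn_univ_iff_mem (N := bicornNeighbor) (by decide +kernel) ?_ (by decide +kernel)
  simp only [bicornMatchings, mem_insert, mem_singleton, forall_eq_or_imp, forall_eq]
  decide +kernel

theorem lonelyNumber_prismGraph : lonelyNumber prismGraph = 6 := by
  have hcount := two_mul_lonelyNumber isMatchingOn_prismGraph_iff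
  have hcard : #{q : Fin 6 × Fin 6 | prismGraph.Adj q.1 q.2 ∧
      #{m ∈ prismMatchings | m q.1 = q.2} = 1} = 12 := by
    decide +kernel
  omega

theorem lonelyNumber_bicornGraph : lonelyNumber bicornGraph = 5 := by
  have hcount := two_mul_lonelyNumber isMatchingOn_bicornGraph_iff
  have hcard : #{q : Fin 8 × Fin 8 | bicornGraph.Adj q.1 q.2 ∧
      #{m ∈ bicornMatchings | m q.1 = q.2} = 1} = 10 := by
    decide +kernel
  omega

theorem exists_prismGraph_iso_apply_zero_eq (v : Fin 6) :
    ∃ α : prismGraph ≃g prismGraph, α 0 = v := by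
  let rows : Fin 6 → Fin 6 → Fin 6 :=
    ![![0, 1, 2, 3, 4, 5], ![1, 2, 0, 4, 5, 3], ![2, 0, 1, 5, 3, 4], ![3, 4, 5, 0, 1, 2],
      ![4, 5, 3, 1, 2, 0], ![5, 3, 4, 2, 0, 1]]
  have hrows : ∀ v, rows v 0 = v ∧ Function.Injective (rows v) ∧
      ∀ a b, prismGraph.Adj (rows v a) (rows v b) ↔ prismGraph.Adj a b := by
    decide +kernel
  obtain ⟨hzero, hinj, hadj⟩ := hrows v
  exact ⟨⟨.ofBijective _ (Finite.injective_iff_bijective.1 hinj), hadj _ _⟩, hzero⟩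

/-- The set of vertices of the bicorn outside the closed neighbourhood of `v`. -/
def bicornFar (v : Fin 8) : Finset (Fin 8) :=
  {w | w ≠ v ∧ ¬ bicornGraph.Adj v w}

theorem exists_isMatchingOn_bicornFar (v : Fin 8) :
    ∃ n, IsMatchingOn bicornGraph (bicornFar v) n ∧
      ∃ w ∈ bicornFar v, IsLonelyEdge bicornGraph w (n w) := by
  let rows : Fin 8 → Fin 8 → Fin 8 :=
    ![![0, 1, 2, 7, 4, 6, 5, 3], ![0, 1, 2, 4, 3, 7, 6, 5], ![0, 1, 2, 3, 5, 4, 7, 6],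
      ![1, 0, 2, 3, 4, 6, 5, 7], ![0, 2, 1, 3, 4, 5, 7, 6], ![1, 0, 3, 2, 4, 5, 6, 7],
      ![2, 1, 0, 4, 3, 5, 6, 7], ![4, 2, 1, 3, 0, 5, 6, 7]]
  have hrows : ∀ v, (∀ w, rows v (rows v w) = w) ∧
      (∀ w ∈ bicornFar v, bicornGraph.Adj w (rows v w)) ∧ (∀ w ∉ bicornFar v, rows v w = w) ∧
      ∃ w ∈ bicornFar v, bicornGraph.Adj w (rows v w) ∧
        #{m ∈ bicornMatchings | m w = rows v w} = 1 := by
    decide +kernel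
  obtain ⟨hinv, hadj, hfix, w, hw, hlonely⟩ := hrows v
  exact ⟨rows v, ⟨hinv, hadj, hfix⟩, w, hw,
    (isLonelyEdge_iff_card_eq_one isMatchingOn_bicornGraph_iff).2 hlonely⟩

end ConcreteGraphs

section Classification

open Function

instance {X : Type*} [DecidableEq X] (K : SimpleGraph X) [DecidableRel K.Adj] (p : Fin 3 → X) :
    DecidableRel (attachTriangle K p).Adj
  | .inl x, .inl y => inferInstanceAs (Decidable (K.Adj x y))
  | .inl x, .inr i => inferInstanceAs (Decidable (p i = x))
  | .inr i, .inl x => inferInstanceAs (Decidable (p i = x))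
  | .inr i, .inr j => inferInstanceAs (Decidable (i ≠ j))

instance {X : Type*} [DecidableEq X] (K : SimpleGraph X) [DecidableRel K.Adj] (p : Fin 3 → X) :
    DecidableRel (attachVertex K p).Adj
  | some x, some y => inferInstanceAs (Decidable (K.Adj x y))
  | some x, none => inferInstanceAs (Decidable (∃ i, p i = x))
  | none, some x => inferInstanceAs (Decidable (∃ i, p i = x))
  | none, none => inferInstanceAs (Decidable False)

/-- The bicorn without its triangle `567`. -/
def bicornCore : SimpleGraph (Fin 5) :=
  bicornGraph.comap (Fin.castAdd 3)

instance : DecidableRel bicornCore.Adj :=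
  inferInstanceAs (DecidableRel (bicornGraph.comap _).Adj)

theorem nonempty_attachTriangle_top_iso_prismGraph :
    Nonempty (attachTriangle (⊤ : SimpleGraph (Fin 3)) id ≃g prismGraph) :=
  ⟨⟨finSumFinEquiv, by decide +kernel⟩⟩

theorem nonempty_attachTriangle_bicornCore_iso_bicornGraph :
    Nonempty (attachTriangle bicornCore ![4, 1, 3] ≃g bicornGraph) :=
  ⟨⟨finSumFinEquiv, by decide +kernel⟩⟩

theorem nonempty_attachVertex_top_iso_completeGraph :
    Nonempty (attachVertex (⊤ : SimpleGraph (Fin 3)) id ≃g (⊤ : SimpleGraph (Fin 4))) :=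
  ⟨⟨(finSuccEquiv 3).symm, by decide +kernel⟩⟩

theorem nonempty_attachVertex_bicornCore_iso_prismGraph :
    Nonempty (attachVertex bicornCore ![4, 1, 3] ≃g prismGraph) :=
  ⟨⟨⟨fun x => x.elim 0 ![4, 3, 5, 2, 1], ![none, some 4, some 3, some 1, some 0, some 2],
    by decide +kernel, by decide +kernel⟩, by decide +kernel⟩⟩

variable {X : Type*} {K : SimpleGraph X} {p : Fin 3 → X}

theorem nonempty_attachTriangle_iso_of_transitive {X' Y : Type*} {K' : SimpleGraph X'}
    {p' : Fin 3 → X'} {H : SimpleGraph Y} (hp : Injective p) (φ : attachVertex K p ≃g H)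
    (ψ : attachVertex K' p' ≃g H) (htrans : ∀ y z, ∃ α : H ≃g H, α y = z) :
    Nonempty (attachTriangle K p ≃g attachTriangle K' p') := by
  obtain ⟨α, hα⟩ := htrans (φ none) (ψ none)
  exact nonempty_attachTriangle_iso hp ((φ.trans α).trans ψ.symm) (by simp [hα])

theorem nonempty_attachTriangle_iso_prismGraph (hp : Injective p)
    (φ : attachVertex K p ≃g (⊤ : SimpleGraph (Fin 4))) :
    Nonempty (attachTriangle K p ≃g prismGraph) := by
  obtain ⟨ψ⟩ := nonempty_attachVertex_top_iso_completeGraph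
  obtain ⟨e⟩ := nonempty_attachTriangle_iso_of_transitive hp φ ψ fun y z =>
    ⟨SimpleGraph.Iso.completeGraph (Equiv.swap y z), Equiv.swap_apply_left y z⟩
  exact nonempty_attachTriangle_top_iso_prismGraph.map e.trans

theorem nonempty_attachTriangle_iso_bicornGraph (hp : Injective p)
    (φ : attachVertex K p ≃g prismGraph) : Nonempty (attachTriangle K p ≃g bicornGraph) := by
  obtain ⟨ψ⟩ := nonempty_attachVertex_bicornCore_iso_prismGraph
  obtain ⟨e⟩ := nonempty_attachTriangle_iso_of_transitive hp φ ψ fun y z => by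
    obtain ⟨α, rfl⟩ := exists_prismGraph_iso_apply_zero_eq y
    obtain ⟨β, rfl⟩ := exists_prismGraph_iso_apply_zero_eq z
    exact ⟨α.symm.trans β, by simp⟩
  exact nonempty_attachTriangle_bicornCore_iso_bicornGraph.map e.trans

theorem lonelyNumber_attachTriangle_lt_five [Fintype X] [DecidableEq X]
    (hG : IsCubic3EdgeConnected (attachTriangle K p)) (hp : Injective p)
    (φ : attachVertex K p ≃g bicornGraph) : lonelyNumber (attachTriangle K p) < 5 := by
  obtain ⟨n, hn, w, hw, hlonely⟩ := exists_isMatchingOn_bicornFar (φ none)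
  rw [← lonelyNumber_bicornGraph, ← lonelyNumber_eq_of_iso φ]
  refine lonelyNumber_attachTriangle_lt hG hp (hn.map φ.symm) (fun z => ?_)
    (mem_map_of_mem _ hw) (by simpa using hlonely.map φ.symm)
  have hmem : z ∈ (bicornFar (φ none)).map φ.symm.toEquiv.toEmbedding ↔ φ z ∈ bicornFar (φ none) :=
    mem_map_equiv
  rw [hmem, bicornFar, mem_filter_univ, φ.injective.ne_iff, φ.map_adj_iff]

variable {V : Type*} [Fintype V] {G : SimpleGraph V}

theorem exists_isLonelyEdge_of_lonelyNumber_pos (h : 0 < lonelyNumber G) :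
    ∃ u v, IsLonelyEdge G u v := by
  obtain ⟨e, he⟩ := Set.nonempty_of_ncard_ne_zero h.ne'
  induction e with
  | _ u v => exact ⟨u, v, he⟩

namespace IsCubic3EdgeConnected

variable [DecidableEq V]

theorem eq_top_of_card_le_four (hG : IsCubic3EdgeConnected G) (hV : Fintype.card V ≤ 4) :
    G = ⊤ := by
  classical
  ext u v
  rw [SimpleGraph.top_adj]
  refine ⟨SimpleGraph.Adj.ne, fun huv => ?_⟩
  have hdegree := hG.edgeCount_singleton_univ u
  rw [edgeCount_singleton] at hdegree
  have hsub : ({w | G.Adj u w} : Finset V) ⊆ univ.erase u := fun w hw =>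
    mem_erase.2 ⟨((mem_filter_univ w).1 hw).ne', mem_univ w⟩
  have hneighbors : ({w | G.Adj u w} : Finset V) = univ.erase u := by
    refine eq_of_subset_of_card_le hsub ?_
    rw [card_erase_of_mem (mem_univ u), card_univ, hdegree]
    omega
  rw [← mem_filter_univ (p := G.Adj u), hneighbors]
  exact mem_erase.2 ⟨huv.symm, mem_univ v⟩

theorem nonempty_iso_completeGraph [Nonempty V] (hG : IsCubic3EdgeConnected G)
    (hV : Fintype.card V ≤ 4) : Nonempty (G ≃g (⊤ : SimpleGraph (Fin 4))) := by
  obtain ⟨v⟩ := ‹Nonempty V›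
  obtain rfl := hG.eq_top_of_card_le_four hV
  have hdegree := hG.edgeCount_singleton_univ v
  have hcard : Fintype.card V = 4 := by
    simp only [edgeCount_singleton, SimpleGraph.top_adj, filter_ne, card_erase_of_mem (mem_univ v),
      card_univ] at hdegree
    omega
  exact ⟨SimpleGraph.Iso.completeGraph (Fintype.equivFinOfCardEq hcard)⟩

theorem nonempty_iso_or_lonelyNumber_le_four (hG : IsCubic3EdgeConnected G) :
    Nonempty (G ≃g (⊤ : SimpleGraph (Fin 4))) ∨ Nonempty (G ≃g prismGraph) ∨
      Nonempty (G ≃g bicornGraph) ∨ lonelyNumber G ≤ 4 := by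
  induction hn : Fintype.card V using Nat.strong_induction_on generalizing V with
  | _ n ih =>
  rcases (lonelyNumber G).eq_zero_or_pos with hzero | hpos
  · omega
  obtain ⟨u, v, huv⟩ := exists_isLonelyEdge_of_lonelyNumber_pos hpos
  rcases le_or_gt (Fintype.card V) 4 with hsmall | hlarge
  · have : Nonempty V := ⟨u⟩
    exact .inl (hG.nonempty_iso_completeGraph hsmall)
  obtain ⟨T, hT⟩ := hG.exists_isNClique_three huv hlarge
  obtain ⟨X, _, _, K, p, hp, ⟨e⟩⟩ := hG.exists_iso_attachTriangle hT hlarge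
  have hK := hG.of_iso e
  have hcard := Fintype.card_congr e.toEquiv
  rw [Fintype.card_sum, Fintype.card_fin] at hcard
  rw [← lonelyNumber_eq_of_iso e]
  rcases ih _ (by rw [Fintype.card_option]; omega) (hK.attachVertex hp) rfl with
    ⟨⟨φ⟩⟩ | ⟨⟨φ⟩⟩ | ⟨⟨φ⟩⟩ | hle
  · exact .inr (.inl ((nonempty_attachTriangle_iso_prismGraph hp φ).map e.symm.trans))
  · exact .inr (.inr (.inl ((nonempty_attachTriangle_iso_bicornGraph hp φ).map e.symm.trans)))
  · exact .inr (.inr (.inr (Nat.le_of_lt_succ (lonelyNumber_attachTriangle_lt_five hK hp φ))))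
  · exact .inr (.inr (.inr ((lonelyNumber_attachTriangle_le hK hp).trans hle)))

end IsCubic3EdgeConnected

end Classification

section VertexConnectivity

variable {V : Type*} {H : SimpleGraph V} {X : Finset V}

theorem card_filter_exists_adj_le [DecidableRel H.Adj] (X Y : Finset V) :
    #{y ∈ Y | ∃ x ∈ X, H.Adj x y} ≤ edgeCount H X Y := by
  classical
  rw [edgeCount_comm, edgeCount_eq_sum, card_eq_sum_ones]
  refine (sum_le_sum fun y hy => ?_).trans (sum_le_sum_of_subset (filter_subset _ Y))
  obtain ⟨-, x, hx, hxy⟩ := mem_filter.1 hy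
  exact edgeCount_pos (mem_singleton_self y) hx hxy.symm

variable [Fintype V]

/-- Vertex-connectivity of simple graphs: `H` has more than `k` vertices, and a set `N` has at least
`k` elements as soon as it contains all neighbours outside `P` of a nonempty set `P` and a vertex
lies outside both. This is connectedness after the deletion of fewer than `k` vertices without
mention of walks. -/
def VertexConnected (k : ℕ) (H : SimpleGraph V) : Prop :=
  k < Fintype.card V ∧ ∀ P N : Finset V, P.Nonempty → Disjoint P N →
    (∀ x ∈ P, ∀ y, H.Adj x y → y ∈ P ∨ y ∈ N) → (∃ z, z ∉ P ∧ z ∉ N) → k ≤ #N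

theorem vertexConnected_iff_forall_finset [DecidableEq V] [DecidableRel H.Adj] {k : ℕ} :
    VertexConnected k H ↔ k < Fintype.card V ∧ ∀ P : Finset V, P.Nonempty →
      (∃ z ∉ P, ∀ x ∈ P, ¬ H.Adj x z) → k ≤ #{z | z ∉ P ∧ ∃ x ∈ P, H.Adj x z} := by
  refine and_congr_right fun _ => ⟨fun h P hP ⟨z, hz, hnadj⟩ => ?_, fun h P N hP _ hN hz => ?_⟩
  · refine h P _ hP (disjoint_left.2 fun y hy hy' => ((mem_filter_univ y).1 hy').1 hy)
      (fun x hx y hxy => ?_) ⟨z, hz, fun hz' => ?_⟩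
    · exact or_iff_not_imp_left.2 fun hy => (mem_filter_univ y).2 ⟨hy, x, hx, hxy⟩
    · obtain ⟨x, hx, hxz⟩ := ((mem_filter_univ z).1 hz').2
      exact hnadj x hx hxz
  · obtain ⟨z, hzP, hzN⟩ := hz
    refine (h P hP ⟨z, hzP, fun x hx hxz => ?_⟩).trans (card_le_card fun y hy => ?_)
    · exact (hN x hx z hxz).elim hzP hzN
    · obtain ⟨hyP, x, hx, hxy⟩ := (mem_filter_univ y).1 hy
      exact (hN x hx y hxy).resolve_left hyP

theorem vertexConnected_completeGraph : VertexConnected 3 (⊤ : SimpleGraph (Fin 4)) :=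
  vertexConnected_iff_forall_finset.2 (by decide +kernel)

theorem vertexConnected_prismGraph : VertexConnected 3 prismGraph :=
  vertexConnected_iff_forall_finset.2 (by decide +kernel)

theorem vertexConnected_bicornGraph : VertexConnected 3 bicornGraph :=
  vertexConnected_iff_forall_finset.2 (by decide +kernel)

variable [DecidableEq V]

theorem exists_edgeCount_erase_le_one (hX : X.Nonempty) (h : boundary H X ≤ 2) :
    ∃ x ∈ X, edgeCount H (X.erase x) Xᶜ ≤ 1 := by
  by_cases hzero : boundary H X = 0
  · obtain ⟨x, hx⟩ := hX
    have := edgeCount_mono (G := H) (erase_subset x X) (Subset.refl Xᶜ)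
    exact ⟨x, hx, by rw [← boundary] at this; omega⟩
  · obtain ⟨x, hx, y, hy, hxy⟩ : ∃ x ∈ X, ∃ y ∈ Xᶜ, H.Adj x y := by
      by_contra! hnone
      exact hzero (edgeCount_eq_zero_iff.2 hnone)
    have hpos := edgeCount_pos (mem_singleton_self x) hy hxy
    have hsplit := edgeCount_union_left (G := H)
      (disjoint_singleton_left.2 (notMem_erase x X)) Xᶜ
    rw [← insert_eq, insert_erase hx, ← boundary] at hsplit
    exact ⟨x, hx, by omega⟩

theorem one_lt_card_of_boundary_le_two (hdegree : ∀ v, edgeCount H {v} univ = 3)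
    (hX : X.Nonempty) (h : boundary H X ≤ 2) : 1 < #X := by
  by_contra! hle
  obtain ⟨x, rfl⟩ := card_eq_one.1 (le_antisymm hle hX.card_pos)
  rw [boundary_singleton, hdegree] at h
  omega

theorem VertexConnected.isCubic3EdgeConnected (hH : VertexConnected 3 H)
    (hdegree : ∀ v, edgeCount H {v} univ = 3) : IsCubic3EdgeConnected H := by
  classical
  refine ⟨hdegree, fun X hX hXc => ?_⟩
  by_contra! hlt
  have hle : boundary H X ≤ 2 := Nat.le_of_lt_succ hlt
  obtain ⟨x, hx, hone⟩ := exists_edgeCount_erase_le_one hX hle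
  have hcardX := one_lt_card_of_boundary_le_two hdegree hX hle
  have hcardXc := one_lt_card_of_boundary_le_two hdegree hXc ((boundary_compl X).trans_le hle)
  let N : Finset V := {y ∈ Xᶜ | ∃ u ∈ X.erase x, H.Adj u y}
  have hcardN : #N ≤ 1 := (card_filter_exists_adj_le _ _).trans hone
  obtain ⟨z, hzX, hzN⟩ := exists_mem_notMem_of_card_lt_card (hcardN.trans_lt hcardXc)
  rw [mem_compl] at hzX
  have hthree := hH.2 (X.erase x) (insert x N)
    (card_pos.1 (by rw [card_erase_of_mem hx]; omega))
    (disjoint_left.2 fun y hy hy' => ?_) (fun u hu y huy => ?_)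
    ⟨z, fun hz => hzX (mem_of_mem_erase hz), fun hz => ?_⟩
  · have := card_insert_le x N
    omega
  · rcases mem_insert.1 hy' with rfl | hyN
    · exact notMem_erase _ _ hy
    · exact mem_compl.1 (mem_filter.1 hyN).1 (mem_of_mem_erase hy)
  · by_cases hy : y ∈ insert x Xᶜ
    · refine .inr ((mem_insert.1 hy).elim (fun h => h ▸ mem_insert_self x N) fun hyX => ?_)
      exact mem_insert_of_mem (mem_filter.2 ⟨hyX, u, hu, huy⟩)
    · rw [mem_insert, mem_compl, not_or, not_not] at hy
      exact .inl (mem_erase.2 hy)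
  · rcases mem_insert.1 hz with rfl | hzN'
    exacts [hzX hx, hzN hzN']

end VertexConnectivity

open scoped Graph

section SimpleModels

variable {α β V V' : Type*} {G : Graph α β} {H : SimpleGraph V} {H' : SimpleGraph V'}

/-- Identification of the multigraph `G` with the simple graph `H`: the vertices and edges of `H`
are relabelled, injectively, as those of `G`. -/
structure SimpleModel (G : Graph α β) (H : SimpleGraph V) where
  vertex : V ↪ α
  edge : H.edgeSet ↪ β
  range_vertex : Set.range vertex = V(G)
  range_edge : Set.range edge = E(G)
  isLink_iff : ∀ (e : H.edgeSet) (v w : V),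
    G.IsLink (edge e) (vertex v) (vertex w) ↔ (e : Sym2 V) = s(v, w)

/-- Transport of a model along an isomorphism of simple graphs. -/
def SimpleModel.ofIso (r : SimpleModel G H) (e : H ≃g H') : SimpleModel G H' where
  vertex := e.symm.toEquiv.toEmbedding.trans r.vertex
  edge := e.symm.mapEdgeSet.toEmbedding.trans r.edge
  range_vertex := (EquivLike.range_comp r.vertex e.symm).trans r.range_vertex
  range_edge := (EquivLike.range_comp r.edge e.symm.mapEdgeSet).trans r.range_edge
  isLink_iff f v w := by
    have hmap : Sym2.map e.symm f = s(e.symm v, e.symm w) ↔ (f : Sym2 V') = s(v, w) :=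
      (Sym2.map.injective e.symm.injective).eq_iff' rfl
    exact (r.isLink_iff _ _ _).trans hmap

theorem isIsomorphic_ofSimpleGraph_iff :
    G.IsIsomorphic (Graph.ofSimpleGraph H) ↔ Nonempty (SimpleModel G H) := by
  constructor
  · rintro ⟨φ, ψ, hlink⟩
    let vertexEquiv : V ≃ V(G) := (φ.trans (Equiv.Set.univ V)).symm
    let edgeEquiv : H.edgeSet ≃ E(G) := ψ.symm
    refine ⟨⟨vertexEquiv.toEmbedding.trans (.subtype _), edgeEquiv.toEmbedding.trans (.subtype _),
      (EquivLike.range_comp Subtype.val vertexEquiv).trans Subtype.range_coe,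
      (EquivLike.range_comp Subtype.val edgeEquiv).trans Subtype.range_coe, fun e v w => ?_⟩⟩
    have hvertex (v) : (φ (vertexEquiv v) : V) = v := vertexEquiv.symm_apply_apply v
    have hedge : (ψ (edgeEquiv e) : Sym2 V) = e := congrArg Subtype.val (ψ.apply_symm_apply e)
    refine (hlink (edgeEquiv e) (vertexEquiv v) (vertexEquiv w)).trans ?_
    rw [hvertex, hvertex, hedge]
    exact and_iff_left e.2
  · rintro ⟨r⟩
    let vertexEquiv : V ≃ V(G) :=
      (Equiv.ofInjective _ r.vertex.injective).trans (Equiv.setCongr r.range_vertex)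
    let edgeEquiv : H.edgeSet ≃ E(G) :=
      (Equiv.ofInjective _ r.edge.injective).trans (Equiv.setCongr r.range_edge)
    refine ⟨vertexEquiv.symm.trans (Equiv.Set.univ V).symm, edgeEquiv.symm, fun e x y => ?_⟩
    obtain ⟨e, rfl⟩ := edgeEquiv.surjective e
    obtain ⟨v, rfl⟩ := vertexEquiv.surjective x
    obtain ⟨w, rfl⟩ := vertexEquiv.surjective y
    have hvertex (v) : vertexEquiv.symm (vertexEquiv v) = v := vertexEquiv.symm_apply_apply v
    have hedge : (edgeEquiv.symm (edgeEquiv e) : Sym2 V) = e :=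
      congrArg Subtype.val (edgeEquiv.symm_apply_apply e)
    refine (r.isLink_iff e v w).trans ((and_iff_left e.2).symm.trans ?_)
    change _ ↔ (Graph.ofSimpleGraph H).IsLink (edgeEquiv.symm (edgeEquiv e) : Sym2 V)
      (vertexEquiv.symm (vertexEquiv v)) (vertexEquiv.symm (vertexEquiv w))
    rw [hvertex, hvertex, hedge]
    exact Iff.rfl

namespace SimpleModel

theorem vertex_mem (r : SimpleModel G H) (v : V) : r.vertex v ∈ V(G) :=
  r.range_vertex ▸ Set.mem_range_self v

theorem exists_vertex_eq (r : SimpleModel G H) {x : α} (hx : x ∈ V(G)) : ∃ v, r.vertex v = x :=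
  (r.range_vertex.symm ▸ hx : x ∈ Set.range r.vertex)

theorem exists_edge_eq (r : SimpleModel G H) {e : β} (he : e ∈ E(G)) :
    ∃ v w, ∃ h : H.Adj v w, r.edge ⟨s(v, w), h⟩ = e := by
  obtain ⟨⟨z, hz⟩, rfl⟩ := (r.range_edge.symm ▸ he : e ∈ Set.range r.edge)
  induction z with
  | _ v w => exact ⟨v, w, hz, rfl⟩

theorem adj_iff (r : SimpleModel G H) {v w : V} :
    G.Adj (r.vertex v) (r.vertex w) ↔ H.Adj v w := by
  refine ⟨fun ⟨e, he⟩ => ?_, fun h => ⟨_, (r.isLink_iff ⟨s(v, w), h⟩ v w).2 rfl⟩⟩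
  obtain ⟨a, b, hab, rfl⟩ := r.exists_edge_eq he.edge_mem
  have hends : s(a, b) = s(v, w) := (r.isLink_iff _ v w).1 he
  rwa [← SimpleGraph.mem_edgeSet, ← hends]

theorem inc_iff (r : SimpleModel G H) {e : H.edgeSet} {v : V} :
    G.Inc (r.edge e) (r.vertex v) ↔ v ∈ (e : Sym2 V) := by
  rw [Sym2.mem_iff_exists]
  refine ⟨fun ⟨x, hx⟩ => ?_, fun ⟨w, hw⟩ => ⟨_, (r.isLink_iff e v w).2 hw⟩⟩
  obtain ⟨w, rfl⟩ := r.exists_vertex_eq hx.right_mem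
  exact ⟨w, (r.isLink_iff e v w).1 hx⟩

theorem loopless (r : SimpleModel G H) : G.Loopless := by
  refine ⟨fun e x hx => ?_⟩
  obtain ⟨v, rfl⟩ := r.exists_vertex_eq hx.vertex_mem
  exact H.irrefl (r.adj_iff.1 ⟨e, hx⟩)

variable [Fintype V]

theorem encard_incidenceSet (r : SimpleModel G H) (v : V) :
    (G.incidenceSet (r.vertex v)).encard = edgeCount H {v} univ := by
  classical
  have himage : G.incidenceSet (r.vertex v) = r.edge '' {e | v ∈ (e : Sym2 V)} := by
    ext e
    refine ⟨fun he => ?_, ?_⟩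
    · obtain ⟨a, b, h, rfl⟩ := r.exists_edge_eq he.edge_mem
      exact ⟨_, r.inc_iff.1 he, rfl⟩
    · rintro ⟨e, he, rfl⟩
      exact r.inc_iff.2 he
  have hval : Subtype.val '' {e : H.edgeSet | v ∈ (e : Sym2 V)} = H.incidenceSet v :=
    Subtype.image_preimage_coe H.edgeSet {e | v ∈ e}
  rw [himage, r.edge.injective.encard_image, ← Subtype.val_injective.encard_image, hval,
    ← SimpleGraph.coe_incidenceFinset, Set.encard_coe_eq_coe_finsetCard,
    SimpleGraph.card_incidenceFinset_eq_degree, edgeCount_singleton, SimpleGraph.degree,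
    SimpleGraph.neighborFinset_eq_filter]

theorem isCubic_iff (r : SimpleModel G H) :
    G.IsCubic ↔ ∀ v, edgeCount H {v} univ = 3 := by
  refine ⟨fun h v => ?_, fun h => ⟨r.loopless, fun x hx => ?_⟩⟩
  · have := h.2 _ (r.vertex_mem v)
    rw [r.encard_incidenceSet] at this
    exact_mod_cast this
  · obtain ⟨v, rfl⟩ := r.exists_vertex_eq hx
    rw [r.encard_incidenceSet, h]
    rfl

theorem encard_vertexSet (r : SimpleModel G H) : V(G).encard = Fintype.card V := by
  rw [← r.range_vertex, ← Set.image_univ, r.vertex.injective.encard_image, Set.encard_univ,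
    ENat.card_eq_coe_fintype_card]

theorem vertexConnected (r : SimpleModel G H) {k : ℕ} (h : G.IsVertexConnected k) :
    VertexConnected k H := by
  obtain ⟨hcard, hconn⟩ := h
  refine ⟨by exact_mod_cast r.encard_vertexSet ▸ hcard, fun P N ⟨p, hp⟩ hd hN ⟨z, hzP, hzN⟩ => ?_⟩
  by_contra! hlt
  have hmem {v} (hv : v ∉ N) : r.vertex v ∈ V(G.deleteVerts (r.vertex '' N)) := by
    rw [Graph.vertexSet_deleteVerts, Set.mem_sdiff, r.vertex.injective.mem_set_image, mem_coe]
    exact ⟨r.vertex_mem v, hv⟩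
  have hwalk := (hconn (r.vertex '' N) (fun x ⟨v, _, hv⟩ => hv ▸ r.vertex_mem v) (by
    rw [r.vertex.injective.encard_image, Set.encard_coe_eq_coe_finsetCard]
    exact_mod_cast hlt)).2 _ (hmem (disjoint_left.1 hd hp)) _ (hmem hzN)
  have hinvariant {x} (hx : Relation.ReflTransGen (G.deleteVerts (r.vertex '' N)).Adj
      (r.vertex p) x) : ∃ v ∈ P, r.vertex v = x := by
    induction hx with
    | refl => exact ⟨p, hp, rfl⟩
    | tail _ hxy ih =>
      obtain ⟨v, hv, rfl⟩ := ih
      obtain ⟨e, he⟩ := hxy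
      rw [Graph.deleteVerts_isLink] at he
      obtain ⟨w, rfl⟩ := r.exists_vertex_eq he.1.right_mem
      refine ⟨w, (hN v hv w (r.adj_iff.1 ⟨e, he.1⟩)).resolve_right fun hw => ?_, rfl⟩
      exact he.2.2 (Set.mem_image_of_mem _ hw)
  obtain ⟨v, hv, hvz⟩ := hinvariant hwalk
  exact hzP (r.vertex.injective hvz ▸ hv)

theorem isVertexConnected (r : SimpleModel G H) {k : ℕ} (h : VertexConnected k H) :
    G.IsVertexConnected k := by
  classical
  obtain ⟨hcard, hseparate⟩ := h
  refine ⟨by rw [r.encard_vertexSet]; exact_mod_cast hcard, fun X hX hXk => ?_⟩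
  let N : Finset V := {v | r.vertex v ∈ X}
  have hNk : #N < k := by
    have himage : r.vertex '' N = X := by
      rw [coe_filter_univ]
      exact Set.image_preimage_eq_of_subset (r.range_vertex ▸ hX)
    rw [← himage, r.vertex.injective.encard_image, Set.encard_coe_eq_coe_finsetCard] at hXk
    exact_mod_cast hXk
  refine ⟨?_, fun x hx y hy => ?_⟩
  · obtain ⟨v, -, hv⟩ := exists_mem_notMem_of_card_lt_card (hNk.trans hcard)
    exact ⟨r.vertex v, r.vertex_mem v, fun h => hv ((mem_filter_univ v).2 h)⟩
  · obtain ⟨v, rfl⟩ := r.exists_vertex_eq hx.1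
    obtain ⟨w, rfl⟩ := r.exists_vertex_eq hy.1
    by_contra hunreachable
    let P : Finset V := {u | r.vertex u ∉ X ∧
      Relation.ReflTransGen (G.deleteVerts X).Adj (r.vertex v) (r.vertex u)}
    refine hNk.not_ge (hseparate P N ⟨v, (mem_filter_univ v).2 ⟨hx.2, .refl⟩⟩ ?_ ?_ ⟨w, ?_, ?_⟩)
    · exact disjoint_filter.2 fun u _ hu => hu.1
    · intro a ha b hab
      rw [mem_filter_univ] at ha
      refine or_iff_not_imp_right.2 fun hb => (mem_filter_univ b).2 ?_
      have hbX : r.vertex b ∉ X := fun h => hb ((mem_filter_univ b).2 h)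
      obtain ⟨e, he⟩ := r.adj_iff.2 hab
      exact ⟨hbX, ha.2.tail ⟨e, (Graph.deleteVerts_isLink _ _).2 ⟨he, ha.1, hbX⟩⟩⟩
    · exact fun hw => hunreachable ((mem_filter_univ w).1 hw).2
    · exact fun hw => hy.2 ((mem_filter_univ w).1 hw)

end SimpleModel

end SimpleModels

namespace SimpleModel

section LonelyEdges

variable {α β V : Type*} {G : Graph α β} {H : SimpleGraph V}

/-- The edge set in `G` of a perfect matching of `H` given by its partner map `m`. -/
def matchingEdges (r : SimpleModel G H) (m : V → V) : Set β :=
  r.edge '' {e | ∃ v, (e : Sym2 V) = s(v, m v)}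

variable [Fintype V] {m : V → V}

theorem edge_mem_matchingEdges_iff (r : SimpleModel G H) (hm : IsMatchingOn H univ m) {u v : V}
    (h : H.Adj u v) : r.edge ⟨s(u, v), h⟩ ∈ r.matchingEdges m ↔ m u = v := by
  rw [matchingEdges, r.edge.injective.mem_set_image]
  refine ⟨fun ⟨w, hw⟩ => ?_, fun huv => ⟨u, congrArg (s(u, ·)) huv.symm⟩⟩
  rcases Sym2.eq_iff.1 hw with ⟨rfl, rfl⟩ | ⟨rfl, rfl⟩
  · rfl
  · exact hm.involutive _

theorem matchingEdges_injOn (r : SimpleModel G H) :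
    Set.InjOn r.matchingEdges {m | IsMatchingOn H univ m} := by
  intro m hm m' hm' h
  funext v
  have hv := (r.edge_mem_matchingEdges_iff hm (hm.adj v (mem_univ v))).2 rfl
  rw [h, r.edge_mem_matchingEdges_iff hm'] at hv
  exact hv.symm

theorem isPerfectMatching_matchingEdges (r : SimpleModel G H) (hm : IsMatchingOn H univ m) :
    G.IsPerfectMatching (r.matchingEdges m) := by
  refine ⟨fun e ⟨f, _, hf⟩ => hf ▸ r.range_edge ▸ Set.mem_range_self f, fun x hx => ?_⟩
  obtain ⟨v, rfl⟩ := r.exists_vertex_eq hx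
  refine ⟨r.edge ⟨s(v, m v), hm.adj v (mem_univ v)⟩,
    ⟨(r.edge_mem_matchingEdges_iff hm _).2 rfl, r.inc_iff.2 (Sym2.mem_mk_left _ _)⟩, ?_⟩
  rintro _ ⟨⟨⟨e, he⟩, ⟨w, rfl⟩, rfl⟩, hinc⟩
  rcases Sym2.mem_iff.1 (r.inc_iff.1 hinc) with rfl | rfl
  · rfl
  · simp only [hm.involutive w, Sym2.eq_swap]

theorem exists_eq_matchingEdges (r : SimpleModel G H) {M : Set β} (hM : G.IsPerfectMatching M) :
    ∃ m, IsMatchingOn H univ m ∧ r.matchingEdges m = M := by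
  have hpartner (v : V) : ∃ w, ∃ h : H.Adj v w, r.edge ⟨s(v, w), h⟩ ∈ M := by
    obtain ⟨_, ⟨he, hinc⟩, -⟩ := hM.2 _ (r.vertex_mem v)
    obtain ⟨a, b, hab, rfl⟩ := r.exists_edge_eq hinc.edge_mem
    rcases Sym2.mem_iff.1 (r.inc_iff.1 hinc) with rfl | rfl
    · exact ⟨b, hab, he⟩
    · exact ⟨a, hab.symm, by simpa only [Sym2.eq_swap] using he⟩
  choose m hadj hmem using hpartner
  have hunique {v w : V} (h : H.Adj v w) (hvw : r.edge ⟨s(v, w), h⟩ ∈ M) : m v = w := by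
    have hedge := (hM.2 _ (r.vertex_mem v)).unique ⟨hvw, r.inc_iff.2 (Sym2.mem_mk_left _ _)⟩
      ⟨hmem v, r.inc_iff.2 (Sym2.mem_mk_left _ _)⟩
    exact (Sym2.congr_right.1 (congrArg Subtype.val (r.edge.injective hedge))).symm
  have hm : IsMatchingOn H univ m := by
    refine ⟨fun v => hunique (hadj v).symm ?_, fun v _ => hadj v,
      fun v hv => absurd (mem_univ v) hv⟩
    simpa only [Sym2.eq_swap] using hmem v
  refine ⟨m, hm, Set.ext fun e => ?_⟩
  constructor
  · rintro ⟨⟨_, _⟩, ⟨v, rfl⟩, rfl⟩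
    exact hmem v
  · intro he
    obtain ⟨a, b, hab, rfl⟩ := r.exists_edge_eq (hM.1 he)
    exact (r.edge_mem_matchingEdges_iff hm hab).2 (hunique hab he)

theorem isLonely_edge_iff (r : SimpleModel G H) {u v : V} (h : H.Adj u v) :
    G.IsLonely (r.edge ⟨s(u, v), h⟩) ↔ IsLonelyEdge H u v := by
  constructor
  · rintro ⟨-, M, ⟨hM, hedge⟩, hunique⟩
    obtain ⟨m, hm, rfl⟩ := r.exists_eq_matchingEdges hM
    refine ⟨h, m, ⟨hm, (r.edge_mem_matchingEdges_iff hm h).1 hedge⟩, fun m' ⟨hm', huv⟩ => ?_⟩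
    exact r.matchingEdges_injOn hm' hm (hunique _
      ⟨r.isPerfectMatching_matchingEdges hm', (r.edge_mem_matchingEdges_iff hm' h).2 huv⟩)
  · rintro ⟨-, m, ⟨hm, huv⟩, hunique⟩
    refine ⟨r.range_edge ▸ Set.mem_range_self _, r.matchingEdges m,
      ⟨r.isPerfectMatching_matchingEdges hm, (r.edge_mem_matchingEdges_iff hm h).2 huv⟩, ?_⟩
    rintro M ⟨hM, hedge⟩
    obtain ⟨m', hm', rfl⟩ := r.exists_eq_matchingEdges hM
    rw [hunique m' ⟨hm', (r.edge_mem_matchingEdges_iff hm' h).1 hedge⟩]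

theorem lonelyCount_eq (r : SimpleModel G H) : G.lonelyCount = lonelyNumber H := by
  have himage : {e | G.IsLonely e} = r.edge '' (Subtype.val ⁻¹' (lonelyGraph H).edgeSet) := by
    ext e
    constructor
    · intro he
      obtain ⟨u, v, h, rfl⟩ := r.exists_edge_eq he.1
      exact ⟨_, (r.isLonely_edge_iff h).1 he, rfl⟩
    · rintro ⟨⟨z, hz⟩, he, rfl⟩
      induction z with
      | _ u v => exact (r.isLonely_edge_iff hz).2 he
  have hle : (lonelyGraph H).edgeSet ⊆ H.edgeSet := SimpleGraph.edgeSet_mono fun _ _ h => h.1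
  rw [Graph.lonelyCount, himage, r.edge.injective.encard_image,
    ← Subtype.val_injective.encard_image, Subtype.image_preimage_coe,
    Set.inter_eq_self_of_subset_right hle, lonelyNumber, Set.Finite.cast_ncard_eq (Set.toFinite _)]

theorem memU_iff (r : SimpleModel G H) : G.MemU ↔
    (∀ v, edgeCount H {v} univ = 3) ∧ VertexConnected 3 H ∧ lonelyNumber H ≠ 0 := by
  have hfinite : V(G).Finite := r.range_vertex ▸ Set.finite_range r.vertex
  have hlonely : (∃ e, G.IsLonely e) ↔ lonelyNumber H ≠ 0 := by
    rw [← Nat.cast_ne_zero (R := ℕ∞), ← r.lonelyCount_eq, Graph.lonelyCount, Set.encard_ne_zero]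
    rfl
  rw [Graph.MemU, r.isCubic_iff, hlonely]
  exact ⟨fun h => ⟨h.2.1, r.vertexConnected h.2.2.1, h.2.2.2⟩,
    fun h => ⟨hfinite, h.1, r.isVertexConnected h.2.1, h.2.2⟩⟩

end LonelyEdges

end SimpleModel

section Simplicity

variable {α β : Type*} {G : Graph α β} {k : ℕ}

theorem le_encard_setOf_adj [G.Loopless] (h : G.IsVertexConnected k) {x : α} (hx : x ∈ V(G)) :
    k ≤ {y | G.Adj x y}.encard := by
  by_contra! hlt
  have hxN : x ∉ {y | G.Adj x y} := G.not_adj_self x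
  obtain ⟨z, hz, hzN⟩ : ∃ z ∈ V(G), z ∉ insert x {y | G.Adj x y} := by
    by_contra! hsub
    have hcard := (Set.encard_le_encard hsub).trans (Set.encard_insert_le _ _)
    exact (h.1.trans_le (hcard.trans (Order.add_one_le_of_lt hlt))).false
  rw [Set.mem_insert_iff, not_or] at hzN
  have hconn := (h.2 {y | G.Adj x y} (fun y hy => Graph.Adj.right_mem hy) hlt).2
  rcases (hconn x ⟨hx, hxN⟩ z ⟨hz, hzN.2⟩).cases_head with hxz | ⟨y, ⟨e, he⟩, -⟩
  · exact hzN.1 hxz.symm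
  · rw [Graph.deleteVerts_isLink] at he
    exact he.2.2 ⟨e, he.1⟩

theorem simple_of_isVertexConnected [G.Loopless] (h : G.IsVertexConnected k)
    (hdegree : ∀ x ∈ V(G), (G.incidenceSet x).encard ≤ k) : G.Simple := by
  refine ⟨fun e f x y he hf => ?_⟩
  by_contra hne
  have hother (z : α) : G.Adj x z → ∃ g, G.IsLink g x z ∧ g ≠ f := by
    rintro ⟨g, hg⟩
    rcases eq_or_ne g f with rfl | hgf
    · exact ⟨e, hf.right_unique hg ▸ he, hne⟩
    · exact ⟨g, hg, hgf⟩
  have : Nonempty β := ⟨e⟩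
  choose! g hg hgf using hother
  have hle : {z | G.Adj x z}.encard ≤ (G.incidenceSet x \ {f}).encard :=
    Set.encard_le_encard_of_injOn (f := g) (fun z hz => ⟨⟨z, hg z hz⟩, hgf z hz⟩)
      fun z hz w hw hzw => (hg z hz).right_unique (hzw ▸ hg w hw)
  have hcard := Set.encard_sdiff_singleton_add_one (s := G.incidenceSet x) (a := f) ⟨y, hf⟩
  have hsucc : (k : ℕ∞) + 1 ≤ k :=
    (add_le_add_left ((le_encard_setOf_adj h he.left_mem).trans hle) 1).trans
      (hcard.le.trans (hdegree x he.left_mem))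
  exact (Nat.lt_succ_self k).not_ge (by exact_mod_cast hsucc)

theorem nonempty_simpleModel [G.Simple] : Nonempty (SimpleModel G G.toSimpleGraph) := by
  have hedge (z : G.toSimpleGraph.edgeSet) :
      ∃ e, ∀ x y : V(G), G.IsLink e x y ↔ (z : Sym2 V(G)) = s(x, y) := by
    obtain ⟨⟨a, b⟩, hab⟩ := z
    obtain ⟨e, he⟩ := (G.toSimpleGraph_adj_iff a b).1 hab
    refine ⟨e, fun x y => he.isLink_iff.trans ?_⟩
    simp only [Sym2.eq_iff, Subtype.ext_iff]
  choose edge isLink_iff using hedge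
  have hinjective : Function.Injective edge := by
    rintro ⟨⟨a, b⟩, hab⟩ z h
    exact Subtype.ext (((isLink_iff z a b).1 (h ▸ (isLink_iff _ a b).2 rfl))).symm
  refine ⟨⟨.subtype _, ⟨edge, hinjective⟩, Subtype.range_coe, ?_, isLink_iff⟩⟩
  refine (Set.range_subset_iff.2 ?_).antisymm fun e he => ?_
  · rintro ⟨⟨a, b⟩, hab⟩
    exact ((isLink_iff _ a b).2 rfl).edge_mem
  · obtain ⟨x, y, hxy⟩ := Graph.exists_isLink_of_mem_edgeSet he
    let x' : V(G) := ⟨x, hxy.left_mem⟩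
    let y' : V(G) := ⟨y, hxy.right_mem⟩
    have hadj : G.toSimpleGraph.Adj x' y' := (G.toSimpleGraph_adj_iff x' y').2 ⟨e, hxy⟩
    exact ⟨⟨s(x', y'), hadj⟩, ((isLink_iff _ x' y').2 rfl).eq hxy⟩

end Simplicity

section Classification

variable {α β : Type*} {G : Graph α β}

theorem isIsomorphic_or_lonelyCount_le_four_of_memU (h : G.MemU) :
    (G.lonelyCount = 6 ∧ (G.IsIsomorphic Graph.completeFour ∨ G.IsIsomorphic Graph.prism)) ∨
      (G.lonelyCount = 5 ∧ G.IsIsomorphic Graph.bicorn) ∨ G.lonelyCount ≤ 4 := by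
  classical
  have := h.1.fintype
  have := h.2.1.1
  have := simple_of_isVertexConnected h.2.2.1 fun x hx => (h.2.1.2 x hx).le
  obtain ⟨r⟩ := nonempty_simpleModel (G := G)
  obtain ⟨hdegree, hconn, -⟩ := r.memU_iff.1 h
  rw [r.lonelyCount_eq]
  rcases (hconn.isCubic3EdgeConnected hdegree).nonempty_iso_or_lonelyNumber_le_four with
    ⟨⟨e⟩⟩ | ⟨⟨e⟩⟩ | ⟨⟨e⟩⟩ | hle
  · have hiso := isIsomorphic_ofSimpleGraph_iff.2 ⟨r.ofIso e⟩
    exact .inl ⟨by rw [lonelyNumber_eq_of_iso e, lonelyNumber_completeGraph]; rfl, .inl hiso⟩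
  · have hiso := isIsomorphic_ofSimpleGraph_iff.2 ⟨r.ofIso e⟩
    exact .inl ⟨by rw [lonelyNumber_eq_of_iso e, lonelyNumber_prismGraph]; rfl, .inr hiso⟩
  · have hiso := isIsomorphic_ofSimpleGraph_iff.2 ⟨r.ofIso e⟩
    exact .inr (.inl ⟨by rw [lonelyNumber_eq_of_iso e, lonelyNumber_bicornGraph]; rfl, hiso⟩)
  · exact .inr (.inr (by exact_mod_cast hle))

theorem memUExactly_of_isIsomorphic {V : Type*} [Fintype V] {H : SimpleGraph V} {k : ℕ}
    (h : G.IsIsomorphic (Graph.ofSimpleGraph H)) (hdegree : ∀ v, edgeCount H {v} univ = 3)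
    (hconn : VertexConnected 3 H) (hk : k ≠ 0) (hlonely : lonelyNumber H = k) :
    G.MemUExactly k := by
  obtain ⟨r⟩ := isIsomorphic_ofSimpleGraph_iff.1 h
  refine ⟨r.memU_iff.2 ⟨hdegree, hconn, hlonely ▸ hk⟩, ?_⟩
  rw [r.lonelyCount_eq, hlonely]

theorem memUExactly_six_of_isIsomorphic_completeFour (h : G.IsIsomorphic Graph.completeFour) :
    G.MemUExactly 6 := by
  refine memUExactly_of_isIsomorphic h (fun v => ?_) vertexConnected_completeGraph (by decide)
    lonelyNumber_completeGraph
  rw [edgeCount_singleton]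
  decide +revert

theorem memUExactly_six_of_isIsomorphic_prism (h : G.IsIsomorphic Graph.prism) :
    G.MemUExactly 6 := by
  refine memUExactly_of_isIsomorphic (H := prismGraph) h (fun v => ?_) vertexConnected_prismGraph
    (by decide) lonelyNumber_prismGraph
  rw [edgeCount_singleton]
  decide +revert

theorem memUExactly_five_of_isIsomorphic_bicorn (h : G.IsIsomorphic Graph.bicorn) :
    G.MemUExactly 5 := by
  refine memUExactly_of_isIsomorphic (H := bicornGraph) h (fun v => ?_) vertexConnected_bicornGraph
    (by decide) lonelyNumber_bicornGraph
  rw [edgeCount_singleton]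
  decide +revert

end Classification

end LonelyEdge

theorem mainTheorem3 {α β : Type*} (G : Graph α β) :
    (G.MemU → G.lonelyCount ≤ 6) ∧
    (G.MemUExactly 6 ↔ G.IsIsomorphic Graph.completeFour ∨ G.IsIsomorphic Graph.prism) ∧
    (G.MemUExactly 5 ↔ G.IsIsomorphic Graph.bicorn) := by
  refine ⟨fun h => ?_, ⟨fun ⟨h, h6⟩ => ?_, ?_⟩, ⟨fun ⟨h, h5⟩ => ?_, ?_⟩⟩
  · rcases LonelyEdge.isIsomorphic_or_lonelyCount_le_four_of_memU h with ⟨hl, -⟩ | ⟨hl, -⟩ | hl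
    · exact hl.le
    · exact hl.le.trans (by decide)
    · exact hl.trans (by decide)
  · rcases LonelyEdge.isIsomorphic_or_lonelyCount_le_four_of_memU h with ⟨-, hiso⟩ | ⟨hl, -⟩ | hl
    · exact hiso
    · exact absurd (h6.symm.trans hl) (by decide)
    · exact absurd (h6 ▸ hl) (by decide)
  · rintro (h | h)
    · exact LonelyEdge.memUExactly_six_of_isIsomorphic_completeFour h
    · exact LonelyEdge.memUExactly_six_of_isIsomorphic_prism h
  · rcases LonelyEdge.isIsomorphic_or_lonelyCount_le_four_of_memU h with ⟨hl, -⟩ | ⟨-, hiso⟩ | hl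
    · exact absurd (h5.symm.trans hl) (by decide)
    · exact hiso
    · exact absurd (h5 ▸ hl) (by decide)
  · exact LonelyEdge.memUExactly_five_of_isIsomorphic_bicorn
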